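/- Let $\mathcal G(n,p,q)$ be the random digraph on $n$ labelled vertices in which, independently for all ordered pairs $(u,v)$ of vertices, the edge $(u,v)$ is present with probability $p$ if $u\neq v$ and with probability $q$ if $u=v$ (a self-loop). A digraph has a \emph{Hamiltonian decomposition} if it contains a family of pairwise vertex-disjoint directed cycles that covers all its vertices; a self-loop counts as a cycle of length one and a pair of opposite edges as a cycle of length two. Let $p(n),q(n)\in[0,1]$ and suppose that $p(n)=\frac{\log n+c(n)+o(1)}{n}$ as $n\to\infty$, where $c(n)$ is a real sequence. Let $P_n$ be the probability that a random digraph from $\mathcal G(n,p(n),q(n))$ has a Hamiltonian decomposition. Then: 1. If $c(n)\to+\infty$, then $P_n\to 1$. 2. If $c(n)=c$ is constant, then $P_n-e^{-2(1-q(n))e^{-c}}\to 0$ as $n\to\infty$. 3. If $c(n)\to-\infty$ and $(1-q(n))e^{-c(n)}\to\infty$, then $P_n\to 0$. (When $c(n)\to-\infty$, the second condition holds in particular if $q(n)$ is bounded away from $1$, for instance if $q(n)$ is a constant smaller than $1$.) -/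

import Mathlib

open Filter Topology MeasureTheory ProbabilityTheory unitInterval

namespace RandomDigraph

/-- A finite cyclic sequence `C` of vertices is a (directed) cycle of the digraph `G`: it is nonempty,
does not repeat a vertex, and each vertex has an edge to the next one, cyclically. A self-loop is a
cycle with one vertex, and a pair of opposite edges is a cycle with two vertices. -/
def IsDirectedCycle {V : Type*} (G : Digraph V) (C : Cycle V) : Prop :=
  C ≠ Cycle.nil ∧ C.Nodup ∧ C.Chain G.Adj

/-- `G` has a Hamiltonian decomposition: a family of pairwise vertex-disjoint directed cycles
of `G` that covers every vertex. -/
def HasHamiltonianDecomposition {V : Type*} (G : Digraph V) : Prop :=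
  ∃ S : Set (Cycle V),
    (∀ C ∈ S, IsDirectedCycle G C) ∧
    (∀ C ∈ S, ∀ D ∈ S, C ≠ D → ∀ v, v ∈ C → v ∉ D) ∧
    ∀ v : V, ∃ C ∈ S, v ∈ C

/-- Every set of digraphs on `{1, …, n}` is an event. -/
instance {n : ℕ} : MeasurableSpace (Digraph (Fin n)) := ⊤

/-- The probability of the edge `e = (u, v)`: it is `q` for a self-loop and `p` otherwise. -/
def edgeProb {n : ℕ} (p q : I) (e : Fin n × Fin n) : I :=
  if e.1 = e.2 then q else p

/-- The digraph whose edges are the ordered pairs `(u, v)` marked `true` by `ω`. -/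
def ofEdges {n : ℕ} (ω : Fin n × Fin n → Bool) : Digraph (Fin n) where
  Adj u v := ω (u, v) = true

/-- The joint law of the edge indicators: independent Bernoulli variables, one for each
ordered pair of (possibly equal) vertices. -/
noncomputable def edgeLaw (n : ℕ) (p q : I) : Measure (Fin n × Fin n → Bool) :=
  Measure.pi fun e => bernoulliMeasure true false (edgeProb p q e)

/-- The random digraph model `G(n, p, q)`, as a law on digraphs with vertex set `Fin n`. -/
noncomputable def gnpq (n : ℕ) (p q : I) : Measure (Digraph (Fin n)) :=
  (edgeLaw n p q).map ofEdges

instance {n : ℕ} (p q : I) : IsProbabilityMeasure (edgeLaw n p q) := by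
  unfold edgeLaw; infer_instance

theorem measurable_ofEdges {n : ℕ} :
    Measurable (ofEdges : (Fin n × Fin n → Bool) → Digraph (Fin n)) :=
  measurable_of_finite _

instance {n : ℕ} (p q : I) : IsProbabilityMeasure (gnpq n p q) :=
  Measure.isProbabilityMeasure_map measurable_ofEdges.aemeasurable

end RandomDigraph

/-! A Hamiltonian decomposition is a permutation that moves every vertex along an edge, i.e. a
perfect matching between rows and columns of the adjacency matrix
(`hasHamiltonianDecomposition_iff_exists_perm`). Zero rows and zero columns obviously prevent one;
the point is that asymptotically nothing else does.

By Hall's theorem, if no row or column vanishes but there is no matching, a smallest deficient set,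
taken over rows and columns together, yields `s ≥ 2` lines, `s` at most about `n / 2`, whose
neighbours form a set of `s - 1` lines, each joined to two of the `s`
(`exists_perm_or_hasSparseSet`). With `L = n p`, a first moment bound for these is of order `n * (C
* L ^ 2 * exp (-p * (n - s))) ^ s` for each `s`. The two neighbours are essential: with only one,
the heuristic count is no longer small near the threshold. The sum tends to 0 whenever `L ≥ log n -
M` (`tendsto_hasSparseRows`), whatever `q` is, since the estimate never uses the probability of a
loop.

It remains to study zero rows and columns. A union bound settles `c → ∞`, and independence of the
rows settles `c → -∞`. For constant `c`, exact inclusion-exclusion (`edgeLaw_real_noZero`) and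
dominated convergence give the square of `exp (-(1 - q) * exp (-c))`, one factor for rows and one
for columns (`tendsto_sum_inclExclTerm_sub`). As `q n` need not converge, differences are shown to
tend to 0 there. -/

namespace RandomDigraph

/-! ### Cycle covers as permutations -/

section Cycles

variable {V : Type*}

theorem _root_.Cycle.Chain.rel_next [DecidableEq V] {r : V → V → Prop} {C : Cycle V}
    (hC : C.Chain r) (hn : C.Nodup) {x : V} (hx : x ∈ C) : r x (C.next hn x hx) := by
  induction C using Quotient.inductionOn' with
  | h l =>
    cases l with
    | nil => simp at hx
    | cons a m =>
      replace hC := (Cycle.chain_coe_cons r a m).1 hC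
      replace hn : (a :: m).Nodup := hn
      replace hx : x ∈ a :: m := hx
      change r x ((a :: m).next x hx)
      obtain ⟨i, hi, rfl⟩ := List.getElem_of_mem hx
      rw [List.next_getElem _ hn]
      have h := List.isChain_iff_getElem.1 hC i (by simp at hi ⊢; omega)
      simp only [← List.cons_append] at h
      rw [List.getElem_append_left hi] at h
      rcases Nat.lt_or_ge (i + 1) (a :: m).length with h1 | h1
      · rw [List.getElem_append_left h1] at h
        simpa only [Nat.mod_eq_of_lt h1] using h
      -- At the last position the successor index wraps to 0; the edge is the one into the closing
      -- copy of `a` that `Cycle.chain_coe_cons` appends.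
      · have h2 : i + 1 = (a :: m).length := by omega
        rw [List.getElem_append_right h1] at h
        simpa [h2] using h

/-- A digraph on a finite vertex set has a Hamiltonian decomposition if and only if some
permutation moves each vertex along an edge. -/
theorem hasHamiltonianDecomposition_iff_exists_perm [Finite V] (G : Digraph V) :
    HasHamiltonianDecomposition G ↔ ∃ τ : Equiv.Perm V, ∀ v, G.Adj v (τ v) := by
  classical
  constructor
  · rintro ⟨S, hS, hdisj, hcov⟩
    choose C hCS hvC using hcov
    let f : V → V := fun v => (C v).next (hS _ (hCS v)).2.1 v (hvC v)
    have hf : Function.Injective f := by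
      -- A common successor lies on both cycles, so disjointness makes them equal, and on one cycle
      -- `prev` undoes `next`.
      intro u v huv
      have hu : f u ∈ C u := Cycle.next_mem _ _ _ _
      have hv : f u ∈ C v := by rw [huv]; exact Cycle.next_mem _ _ _ _
      have hC : C u = C v := by
        by_contra hne
        exact hdisj _ (hCS u) _ (hCS v) hne _ hu hv
      have hvu : v ∈ C u := hC ▸ hvC v
      have hfv : f v = (C u).next (hS _ (hCS u)).2.1 v hvu := by
        simp only [f]; congr 1; exact hC.symm
      have h1 := Cycle.prev_next (C u) (hS _ (hCS u)).2.1 u (hvC u)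
      have h2 := Cycle.prev_next (C u) (hS _ (hCS u)).2.1 v hvu
      rw [← h1, ← h2]
      congr 1
      rw [← hfv, ← huv]
    refine ⟨Equiv.ofBijective f (Finite.injective_iff_bijective.1 hf), fun v => ?_⟩
    exact (hS _ (hCS v)).2.2.rel_next _ (hvC v)
  · rintro ⟨τ, hτ⟩
    have hper : ∀ x, x ∈ Function.periodicPts τ := fun x =>
      τ.injective.mem_periodicPts x
    refine ⟨Set.range (Function.periodicOrbit τ), ?_, ?_, fun v =>
      ⟨_, ⟨v, rfl⟩, Function.self_mem_periodicOrbit (hper v)⟩⟩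
    · rintro _ ⟨x, rfl⟩
      refine ⟨?_, Function.nodup_periodicOrbit, ?_⟩
      · rw [Ne, Function.periodicOrbit_eq_nil_iff_not_periodic_pt]
        exact not_not.2 (hper x)
      · rw [Function.periodicOrbit_chain' _ (hper x)]
        intro n
        rw [Function.iterate_succ_apply']
        exact hτ _
    · rintro _ ⟨x, rfl⟩ _ ⟨y, rfl⟩ hne v hvx hvy
      apply hne
      rw [Function.mem_periodicOrbit_iff (hper _)] at hvx hvy
      obtain ⟨a, rfl⟩ := hvx
      obtain ⟨b, hb⟩ := hvy
      rw [← Function.periodicOrbit_apply_iterate_eq (hper x) a, ← hb,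
        Function.periodicOrbit_apply_iterate_eq (hper y) b]

end Cycles

/-! ### Minimal violations of Hall's condition -/

section Hall

variable {V : Type*} [Fintype V] [DecidableEq V]

/-- A minimal obstruction to a perfect matching of `r` other than an isolated vertex: a set `S`
of at least two and at most about half of the rows whose neighbours all lie in a set `T`
with one element less, each of which has two neighbours in `S`. -/
def HasSparseSet (r : V → V → Prop) : Prop :=
  ∃ S T : Finset V, 2 ≤ S.card ∧ 2 * S.card ≤ Fintype.card V + 1 ∧ T.card + 1 = S.card ∧
    (∀ i ∈ S, ∀ j ∉ T, ¬ r i j) ∧ ∀ j ∈ T, ∃ i ∈ S, ∃ i' ∈ S, i ≠ i' ∧ r i j ∧ r i' j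

open Classical in
/-- The set of neighbours of the elements of `S`. -/
noncomputable def nbrs (r : V → V → Prop) (S : Finset V) : Finset V :=
  {j | ∃ i ∈ S, r i j}

omit [DecidableEq V] in
theorem mem_nbrs {r : V → V → Prop} {S : Finset V} {j : V} :
    j ∈ nbrs r S ↔ ∃ i ∈ S, r i j := by
  simp [nbrs]

/-- Every property of the obstruction comes from a smaller deficient set that would exist without
it. Minimality among columns as well as rows is what bounds `S` by half of the vertices. -/
theorem hasSparseSet_of_minimal_deficient {r : V → V → Prop} {S : Finset V}
    (hrow : ∀ i, ∃ j, r i j) (hS : (nbrs r S).card < S.card)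
    (hmin : ∀ S' : Finset V, (nbrs r S').card < S'.card → S.card ≤ S'.card)
    (hmin' : ∀ S' : Finset V, (nbrs (flip r) S').card < S'.card → S.card ≤ S'.card) :
    HasSparseSet r := by
  have hmono : ∀ {S₁ S₂ : Finset V}, S₁ ⊆ S₂ → nbrs r S₁ ⊆ nbrs r S₂ := by
    intro S₁ S₂ h j hj
    obtain ⟨i, hi, hij⟩ := mem_nbrs.1 hj
    exact mem_nbrs.2 ⟨i, h hi, hij⟩
  have hpos : 0 < S.card := by omega
  obtain ⟨x, hx⟩ := Finset.card_pos.1 hpos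
  have hcard : (nbrs r S).card + 1 = S.card := by
    by_contra hne
    have h1 : (S.erase x).card = S.card - 1 := Finset.card_erase_of_mem hx
    have h2 := Finset.card_le_card (hmono (Finset.erase_subset x S))
    have := hmin (S.erase x) (by omega)
    omega
  have htwo : 2 ≤ S.card := by
    obtain ⟨j, hj⟩ := hrow x
    have : 0 < (nbrs r S).card := Finset.card_pos.2 ⟨j, mem_nbrs.2 ⟨x, hx, hj⟩⟩
    omega
  refine ⟨S, nbrs r S, htwo, ?_, hcard, ?_, ?_⟩
  -- The columns outside the neighbourhood form a deficient set too: there are `n - S.card + 1` of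
  -- them, with neighbours only among the `n - S.card` rows outside `S`.
  · have hsub : nbrs (flip r) (nbrs r S)ᶜ ⊆ Sᶜ := by
      intro i hi
      obtain ⟨j, hj, hij⟩ := mem_nbrs.1 hi
      rw [Finset.mem_compl] at hj ⊢
      exact fun hiS => hj (mem_nbrs.2 ⟨i, hiS, hij⟩)
    have h1 := Finset.card_le_card hsub
    have h2 := Finset.card_le_univ S
    have h3 := Finset.card_le_univ (nbrs r S)
    rw [Finset.card_compl] at h1
    have h4 := hmin' (nbrs r S)ᶜ (by rw [Finset.card_compl]; omega)
    rw [Finset.card_compl] at h4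
    omega
  · intro i hi j hj hij
    exact hj (mem_nbrs.2 ⟨i, hi, hij⟩)
  · intro j hj
    obtain ⟨i, hi, hij⟩ := mem_nbrs.1 hj
    by_contra hcon
    push Not at hcon
    -- If `i` were the only neighbour of `j` in `S`, deleting `i` would also delete `j` from the
    -- neighbourhood and keep the deficiency.
    have hsub : nbrs r (S.erase i) ⊆ (nbrs r S).erase j := by
      intro k hk
      obtain ⟨i', hi', hik⟩ := mem_nbrs.1 hk
      rw [Finset.mem_erase] at hi'
      refine Finset.mem_erase.2 ⟨?_, mem_nbrs.2 ⟨i', hi'.2, hik⟩⟩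
      rintro rfl
      exact hcon i hi i' hi'.2 (Ne.symm hi'.1) hij hik
    have h1 := Finset.card_le_card hsub
    rw [Finset.card_erase_of_mem hj] at h1
    have h2 : (S.erase i).card = S.card - 1 := Finset.card_erase_of_mem hi
    have := hmin (S.erase i) (by omega)
    omega

theorem exists_perm_or_hasSparseSet {r : V → V → Prop}
    (hrow : ∀ i, ∃ j, r i j) (hcol : ∀ j, ∃ i, r i j) :
    (∃ τ : Equiv.Perm V, ∀ i, r i (τ i)) ∨ HasSparseSet r ∨ HasSparseSet (flip r) := by
  classical
  by_cases hall : ∀ S : Finset V, S.card ≤ (nbrs r S).card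
  · left
    have hall' : ∀ S : Finset V, S.card ≤ (Finset.univ.filter fun j => ∃ i ∈ S, r i j).card := by
      intro S
      convert hall S
      ext j; simp [mem_nbrs]
    obtain ⟨f, hf, hr⟩ := (Fintype.all_card_le_filter_rel_iff_exists_injective r).1 hall'
    exact ⟨Equiv.ofBijective f (Finite.injective_iff_bijective.1 hf), hr⟩
  · right
    push Not at hall
    obtain ⟨S₀, hS₀⟩ := hall
    have hex : ∃ s : ℕ, ∃ S : Finset V, S.card = s ∧
        ((nbrs r S).card < S.card ∨ (nbrs (flip r) S).card < S.card) := ⟨_, S₀, rfl, Or.inl hS₀⟩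
    obtain ⟨S, hSs, hS⟩ := Nat.find_spec hex
    have hmin : ∀ S' : Finset V,
        ((nbrs r S').card < S'.card ∨ (nbrs (flip r) S').card < S'.card) → S.card ≤ S'.card := by
      intro S' hS'
      rw [hSs]
      exact Nat.find_min' hex ⟨S', rfl, hS'⟩
    rcases hS with hS | hS
    · exact Or.inl (hasSparseSet_of_minimal_deficient hrow hS (fun S' h => hmin S' (Or.inl h))
        fun S' h => hmin S' (Or.inr h))
    · exact Or.inr (hasSparseSet_of_minimal_deficient hcol hS (fun S' h => hmin S' (Or.inr h))
        fun S' h => hmin S' (Or.inl h))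

end Hall

/-! ### Probabilities of edge events -/

section Law

variable {n : ℕ} (p q : I)

theorem edgeLaw_real_pi (s : Fin n × Fin n → Set Bool) :
    (edgeLaw n p q).real {ω | ∀ e, ω e ∈ s e} =
      ∏ e, (bernoulliMeasure true false (edgeProb p q e)).real (s e) := by
  have : {ω : Fin n × Fin n → Bool | ∀ e, ω e ∈ s e} = Set.univ.pi s := by
    ext ω; simp [Set.mem_pi]
  rw [this, edgeLaw, measureReal_def, Measure.pi_pi, ENNReal.toReal_prod]
  rfl

/-- The probability that all edges of `A` are absent and all edges of `B` are present. -/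
theorem edgeLaw_real_absent_present {A B : Finset (Fin n × Fin n)} (h : Disjoint A B) :
    (edgeLaw n p q).real {ω | (∀ e ∈ A, ω e = false) ∧ ∀ e ∈ B, ω e = true} =
      (∏ e ∈ A, (1 - (edgeProb p q e : ℝ))) * ∏ e ∈ B, (edgeProb p q e : ℝ) := by
  classical
  have hset : {ω : Fin n × Fin n → Bool | (∀ e ∈ A, ω e = false) ∧ ∀ e ∈ B, ω e = true} =
      {ω | ∀ e, ω e ∈ (if e ∈ A then {false} else if e ∈ B then {true} else Set.univ :
        Set Bool)} := by
    ext ω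
    simp only [Set.mem_ofPred_eq]
    constructor
    · rintro ⟨h1, h2⟩ e
      split_ifs with hA hB
      · exact h1 e hA
      · exact h2 e hB
      · trivial
    · intro h1
      refine ⟨fun e he => by simpa [he] using h1 e, fun e he => ?_⟩
      simpa [he, Finset.disjoint_right.1 h he] using h1 e
  rw [hset, edgeLaw_real_pi]
  have hA : ∏ e ∈ A, (1 - (edgeProb p q e : ℝ)) =
      ∏ e, if e ∈ A then (1 - (edgeProb p q e : ℝ)) else 1 := by simp
  have hB : ∏ e ∈ B, (edgeProb p q e : ℝ) =
      ∏ e, if e ∈ B then (edgeProb p q e : ℝ) else 1 := by simp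
  rw [hA, hB, ← Finset.prod_mul_distrib]
  refine Finset.prod_congr rfl fun e _ => ?_
  by_cases he : e ∈ A
  · have he' : e ∉ B := Finset.disjoint_left.1 h he
    simp [he, he']
  · by_cases he' : e ∈ B
    · simp [he, he']
    · simp [he, he']

theorem edgeLaw_real_absent (A : Finset (Fin n × Fin n)) :
    (edgeLaw n p q).real {ω | ∀ e ∈ A, ω e = false} =
      ∏ e ∈ A, (1 - (edgeProb p q e : ℝ)) := by
  simpa using edgeLaw_real_absent_present p q (Finset.disjoint_empty_right A)

theorem edgeProb_swap (e : Fin n × Fin n) : edgeProb p q e.swap = edgeProb p q e := by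
  simp [edgeProb, eq_comm]

/-- The law of the edge indicators is invariant under reversal of all edges. -/
theorem edgeLaw_real_comp_swap (P : (Fin n × Fin n → Bool) → Prop) :
    (edgeLaw n p q).real {ω | P (ω ∘ Prod.swap)} = (edgeLaw n p q).real {ω | P ω} := by
  have h := measurePreserving_piCongrLeft (α := fun _ : Fin n × Fin n => Bool)
    (fun e => bernoulliMeasure true false (edgeProb p q e)) (Equiv.prodComm (Fin n) (Fin n))
  have hlaw : (Measure.pi fun e : Fin n × Fin n =>
      bernoulliMeasure true false (edgeProb p q (Equiv.prodComm (Fin n) (Fin n) e))) =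
      edgeLaw n p q := by
    simp only [Equiv.prodComm_apply, edgeProb_swap]
    rfl
  rw [hlaw] at h
  have := h.measureReal_preimage (s := {ω | P ω}) (Set.toFinite _).measurableSet.nullMeasurableSet
  rw [← edgeLaw] at this
  rw [← this]
  congr 1

theorem gnpq_real_apply (S : Set (Digraph (Fin n))) :
    (gnpq n p q).real S = (edgeLaw n p q).real {ω | ofEdges ω ∈ S} := by
  rw [gnpq, map_measureReal_apply measurable_ofEdges trivial]
  rfl

end Law

/-! ### Inclusion-exclusion for zero rows and columns -/

section Isolated

variable {n : ℕ}

/-- Every vertex has an out-edge. -/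
def NoZeroRow (ω : Fin n × Fin n → Bool) : Prop := ∀ i, ∃ j, ω (i, j) = true

variable (p q : I)

theorem prod_one_sub_edgeProb_row (i : Fin n) (B : Finset (Fin n)) :
    ∏ j ∈ B, (1 - (edgeProb p q (i, j) : ℝ)) =
      if i ∈ B then (1 - (q : ℝ)) * (1 - p) ^ (B.card - 1) else (1 - (p : ℝ)) ^ B.card := by
  have hne : ∀ j, j ≠ i → (edgeProb p q (i, j) : ℝ) = p := by
    intro j hj
    simp [edgeProb, hj.symm]
  split_ifs with hi
  · rw [← Finset.mul_prod_erase _ _ hi, ← Finset.card_erase_of_mem hi, ← Finset.prod_const]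
    congr 1
    · simp [edgeProb]
    · exact Finset.prod_congr rfl fun j hj => by rw [hne j (Finset.ne_of_mem_erase hj)]
  · rw [← Finset.prod_const]
    exact Finset.prod_congr rfl fun j hj => by rw [hne j (by rintro rfl; exact hi hj)]

open Classical in
/-- The indicator of a proposition. -/
noncomputable def ind (P : Prop) : ℝ := if P then 1 else 0

theorem ind_and (P Q : Prop) : ind (P ∧ Q) = ind P * ind Q := by
  by_cases hP : P <;> by_cases hQ : Q <;> simp [ind, hP, hQ]

/-- Integrating a pointwise identity between indicators; this turns inclusion-exclusion into a
statement about probabilities. -/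
theorem edgeLaw_real_eq_sum (P : (Fin n × Fin n → Bool) → Prop) {ι : Type*} (s : Finset ι)
    (a : ι → ℝ) (E : ι → (Fin n × Fin n → Bool) → Prop)
    (h : ∀ ω, ind (P ω) = ∑ k ∈ s, a k * ind (E k ω)) :
    (edgeLaw n p q).real {ω | P ω} = ∑ k ∈ s, a k * (edgeLaw n p q).real {ω | E k ω} := by
  have hI : ∀ Q : (Fin n × Fin n → Bool) → Prop,
      (edgeLaw n p q).real {ω | Q ω} = ∫ ω, ind (Q ω) ∂edgeLaw n p q := by
    intro Q
    rw [← integral_indicator_one (Set.toFinite _).measurableSet]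
    rfl
  rw [hI, integral_congr_ae (Eventually.of_forall h), integral_finsetSum]
  · exact Finset.sum_congr rfl fun k _ => by rw [integral_const_mul, hI]
  · exact fun k _ => .of_finite

theorem ind_forall_not_eq_sum {ι : Type*} [Fintype ι] (Z : ι → Prop) :
    ind (∀ i, ¬ Z i) = ∑ A : Finset ι, (-1) ^ A.card * ind (∀ i ∈ A, Z i) := by
  classical
  simp only [ind]
  have h := Finset.prod_sub (fun _ : ι => (1 : ℝ)) (fun i => if Z i then 1 else 0) Finset.univ
  simp only [Finset.prod_const_one, mul_one, Finset.powerset_univ, Finset.prod_ite_zero] at h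
  refine (Eq.trans ?_ h).trans (Finset.sum_congr rfl fun A _ => by congr)
  have : ∀ i, (1 : ℝ) - (if Z i then 1 else 0) = if ¬ Z i then 1 else 0 := by
    intro i; split_ifs <;> simp
  simp only [this, Finset.prod_ite_zero, Finset.prod_const_one, Finset.mem_univ, true_imp_iff]
  congr

/-- The probability that the rows outside `A` are unconstrained, the rows in `A` vanish and the
columns in `B` vanish. -/
theorem edgeLaw_real_rows_cols (A B : Finset (Fin n)) :
    (edgeLaw n p q).real {ω | (∀ i ∈ A, ∀ j, ω (i, j) = false) ∧ ∀ j ∈ B, ∀ i, ω (i, j) = false} =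
      (∏ i ∈ Finset.univ \ A, ∏ j ∈ B, (1 - (edgeProb p q (i, j) : ℝ))) *
        ∏ i ∈ A, ∏ j, (1 - (edgeProb p q (i, j) : ℝ)) := by
  have hset : {ω : Fin n × Fin n → Bool |
      (∀ i ∈ A, ∀ j, ω (i, j) = false) ∧ ∀ j ∈ B, ∀ i, ω (i, j) = false} =
      {ω | ∀ e ∈ Finset.univ.filter (fun e : Fin n × Fin n => e.1 ∈ A ∨ e.2 ∈ B),
        ω e = false} := by
    ext ω
    simp only [Set.mem_ofPred_eq, Finset.mem_filter, Finset.mem_univ, true_and, Prod.forall]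
    grind
  rw [hset, edgeLaw_real_absent, Finset.prod_filter, Fintype.prod_prod_type,
    ← Finset.prod_sdiff (Finset.subset_univ A)]
  congr 1
  · refine Finset.prod_congr rfl fun i hi => ?_
    have : i ∉ A := (Finset.mem_sdiff.1 hi).2
    simp [this]
  · refine Finset.prod_congr rfl fun i hi => ?_
    simp [hi]

/-- The probability that no vertex lacks out-edges or in-edges. -/
theorem edgeLaw_real_noZero :
    (edgeLaw n p q).real {ω | NoZeroRow ω ∧ NoZeroRow (ω ∘ Prod.swap)} =
      ∑ b ∈ Finset.range (n + 1), (-1 : ℝ) ^ b * n.choose b *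
        (((1 - p : ℝ) ^ b - (1 - q) * (1 - p) ^ (n - 1)) ^ (n - b) *
          ((1 - q) * (1 - p : ℝ) ^ (b - 1) - (1 - q) * (1 - p) ^ (n - 1)) ^ b) := by
  classical
  have h1 : (edgeLaw n p q).real {ω | NoZeroRow ω ∧ NoZeroRow (ω ∘ Prod.swap)} =
      ∑ k ∈ (Finset.univ : Finset (Finset (Fin n) × Finset (Fin n))),
        ((-1 : ℝ) ^ k.1.card * (-1) ^ k.2.card) * (edgeLaw n p q).real
        {ω | (∀ i ∈ k.1, ∀ j, ω (i, j) = false) ∧ ∀ j ∈ k.2, ∀ i, ω (i, j) = false} := by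
    apply edgeLaw_real_eq_sum
    intro ω
    have hr := ind_forall_not_eq_sum (fun i : Fin n => ∀ j, ω (i, j) = false)
    have hc := ind_forall_not_eq_sum (fun j : Fin n => ∀ i, ω (i, j) = false)
    have hP : (NoZeroRow ω ∧ NoZeroRow (ω ∘ Prod.swap)) ↔
        ((∀ i, ¬ ∀ j, ω (i, j) = false) ∧ ∀ j, ¬ ∀ i, ω (i, j) = false) := by
      simp [NoZeroRow]
    rw [propext hP, ind_and, hr, hc, Finset.sum_mul_sum, Fintype.sum_prod_type]
    refine Finset.sum_congr rfl fun A _ => Finset.sum_congr rfl fun B _ => ?_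
    rw [ind_and]
    ring
  rw [h1, Fintype.sum_prod_type_right]
  have h2 : ∀ B : Finset (Fin n), ∑ A : Finset (Fin n), ((-1 : ℝ) ^ A.card * (-1) ^ B.card) *
        (edgeLaw n p q).real
        {ω | (∀ i ∈ A, ∀ j, ω (i, j) = false) ∧ ∀ j ∈ B, ∀ i, ω (i, j) = false} =
      (-1) ^ B.card * (((1 - p : ℝ) ^ B.card - (1 - q) * (1 - p) ^ (n - 1)) ^ (n - B.card) *
          ((1 - q) * (1 - p : ℝ) ^ (B.card - 1) - (1 - q) * (1 - p) ^ (n - 1)) ^ B.card) := by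
    intro B
    -- For fixed `B` the alternating sum over `A` is the expansion of a product over rows: row `i`
    -- contributes the probability that it vanishes on `B` but not everywhere. Only a sum over `B`
    -- is left.
    have h3 := Finset.prod_sub (fun i : Fin n => ∏ j ∈ B, (1 - (edgeProb p q (i, j) : ℝ)))
      (fun i => ∏ j, (1 - (edgeProb p q (i, j) : ℝ))) Finset.univ
    have h4 : ∏ i : Fin n, (∏ j ∈ B, (1 - (edgeProb p q (i, j) : ℝ)) -
        ∏ j, (1 - (edgeProb p q (i, j) : ℝ))) =
        ((1 - p : ℝ) ^ B.card - (1 - q) * (1 - p) ^ (n - 1)) ^ (n - B.card) *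
          ((1 - q) * (1 - p : ℝ) ^ (B.card - 1) - (1 - q) * (1 - p) ^ (n - 1)) ^ B.card := by
      simp only [prod_one_sub_edgeProb_row, Finset.mem_univ, if_true, Finset.card_univ,
        Fintype.card_fin]
      rw [← Finset.prod_sdiff (Finset.subset_univ B)]
      congr 1
      · rw [Finset.prod_congr rfl fun i hi => by rw [if_neg (Finset.mem_sdiff.1 hi).2]]
        simp [Finset.card_sdiff]
      · rw [Finset.prod_congr rfl fun i hi => by rw [if_pos hi]]
        simp
    rw [← h4, h3, Finset.powerset_univ, Finset.mul_sum]
    refine Finset.sum_congr rfl fun A _ => ?_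
    rw [edgeLaw_real_rows_cols]
    ring
  simp only [h2]
  rw [← Finset.powerset_univ, Finset.sum_powerset_apply_card (fun b => (-1 : ℝ) ^ b *
    (((1 - p : ℝ) ^ b - (1 - q) * (1 - p) ^ (n - 1)) ^ (n - b) *
          ((1 - q) * (1 - p : ℝ) ^ (b - 1) - (1 - q) * (1 - p) ^ (n - 1)) ^ b)),
    Finset.card_univ, Fintype.card_fin]
  refine Finset.sum_congr rfl fun b _ => ?_
  rw [nsmul_eq_mul]
  ring

/-- The rows are independent, so the probability that none of them vanishes is a power. -/
theorem edgeLaw_real_noZeroRow :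
    (edgeLaw n p q).real {ω | NoZeroRow ω} =
      (1 - (1 - q : ℝ) * (1 - p) ^ (n - 1)) ^ n := by
  classical
  have h1 : (edgeLaw n p q).real {ω | NoZeroRow ω} =
      ∑ A : Finset (Fin n), (-1 : ℝ) ^ A.card * (edgeLaw n p q).real
        {ω | (∀ i ∈ A, ∀ j, ω (i, j) = false) ∧
          ∀ j ∈ (∅ : Finset (Fin n)), ∀ i, ω (i, j) = false} := by
    apply edgeLaw_real_eq_sum
    intro ω
    have hr := ind_forall_not_eq_sum (fun i : Fin n => ∀ j, ω (i, j) = false)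
    have hP : NoZeroRow ω ↔ ∀ i, ¬ ∀ j, ω (i, j) = false := by
      simp [NoZeroRow]
    rw [propext hP, hr]
    simp
  have h3 := Finset.prod_sub (fun _ : Fin n => (1 : ℝ))
      (fun i => ∏ j, (1 - (edgeProb p q (i, j) : ℝ))) Finset.univ
  simp only [prod_one_sub_edgeProb_row, Finset.mem_univ, if_true, Finset.card_univ,
    Fintype.card_fin, Finset.prod_const] at h3
  rw [h1, h3, Finset.powerset_univ]
  refine Finset.sum_congr rfl fun A _ => ?_
  rw [edgeLaw_real_rows_cols]
  simp [prod_one_sub_edgeProb_row]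

end Isolated

/-! ### Reduction to zero lines and sparse sets -/

section Decomposition

variable {n : ℕ} (p q : I)

/-- The edges marked by `ω` contain the obstruction `HasSparseSet`. -/
def HasSparseRows (ω : Fin n × Fin n → Bool) : Prop :=
  HasSparseSet fun i j => ω (i, j) = true

theorem noZeroRow_of_hasHamiltonianDecomposition {ω : Fin n × Fin n → Bool}
    (h : HasHamiltonianDecomposition (ofEdges ω)) :
    NoZeroRow ω ∧ NoZeroRow (ω ∘ Prod.swap) := by
  obtain ⟨τ, hτ⟩ := (hasHamiltonianDecomposition_iff_exists_perm _).1 h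
  refine ⟨fun i => ⟨τ i, hτ i⟩, fun j => ⟨τ.symm j, ?_⟩⟩
  simpa [ofEdges] using hτ (τ.symm j)

theorem hasHamiltonianDecomposition_or_hasSparseRows {ω : Fin n × Fin n → Bool}
    (h : NoZeroRow ω) (h' : NoZeroRow (ω ∘ Prod.swap)) :
    HasHamiltonianDecomposition (ofEdges ω) ∨
      HasSparseRows ω ∨ HasSparseRows (ω ∘ Prod.swap) := by
  rw [hasHamiltonianDecomposition_iff_exists_perm]
  exact exists_perm_or_hasSparseSet (r := fun i j => ω (i, j) = true) h h'

theorem gnpq_real_hasHamiltonianDecomposition_le :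
    (gnpq n p q).real {G | HasHamiltonianDecomposition G} ≤
      (edgeLaw n p q).real {ω | NoZeroRow ω ∧ NoZeroRow (ω ∘ Prod.swap)} := by
  rw [gnpq_real_apply]
  exact measureReal_mono fun ω h => noZeroRow_of_hasHamiltonianDecomposition h

/-- The factor 2 covers sparse sets of rows and of columns, which are equally likely because
reversing all edges preserves the law. -/
theorem edgeLaw_real_noZero_le :
    (edgeLaw n p q).real {ω | NoZeroRow ω ∧ NoZeroRow (ω ∘ Prod.swap)} ≤
      (gnpq n p q).real {G | HasHamiltonianDecomposition G} +
        2 * (edgeLaw n p q).real {ω | HasSparseRows ω} := by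
  rw [gnpq_real_apply]
  have hsub : {ω : Fin n × Fin n → Bool | NoZeroRow ω ∧ NoZeroRow (ω ∘ Prod.swap)} ⊆
      {ω | ofEdges ω ∈ {G | HasHamiltonianDecomposition G}} ∪
        ({ω | HasSparseRows ω} ∪ {ω | HasSparseRows (ω ∘ Prod.swap)}) :=
    fun ω h => hasHamiltonianDecomposition_or_hasSparseRows h.1 h.2
  refine (measureReal_mono hsub).trans ((measureReal_union_le _ _).trans ?_)
  gcongr
  refine (measureReal_union_le _ _).trans ?_
  rw [edgeLaw_real_comp_swap, two_mul]

/-- The probability that some vertex lacks out-edges or in-edges. -/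
theorem one_sub_edgeLaw_real_noZero_le :
    1 - (edgeLaw n p q).real {ω | NoZeroRow ω ∧ NoZeroRow (ω ∘ Prod.swap)} ≤
      2 * (n * ((1 - q : ℝ) * (1 - p) ^ (n - 1))) := by
  set N : Set (Fin n × Fin n → Bool) := {ω | NoZeroRow ω}
  set N' : Set (Fin n × Fin n → Bool) := {ω | NoZeroRow (ω ∘ Prod.swap)}
  have hmeas : ∀ s : Set (Fin n × Fin n → Bool), MeasurableSet s :=
    fun s => (Set.toFinite s).measurableSet
  have h1 : (edgeLaw n p q).real (Nᶜ) ≤ n * ((1 - q : ℝ) * (1 - p) ^ (n - 1)) := by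
    rw [probReal_compl_eq_one_sub (hmeas _), edgeLaw_real_noZeroRow]
    have hb := one_add_mul_le_pow (a := -((1 - q : ℝ) * (1 - p) ^ (n - 1))) (by
      have hq := q.2.1
      have hp := p.2.1
      have hp' := p.2.2
      have hq' := q.2.2
      have : (1 - p : ℝ) ^ (n - 1) ≤ 1 := pow_le_one₀ (by linarith) (by linarith)
      have h0 : (0 : ℝ) ≤ (1 - p : ℝ) ^ (n - 1) := pow_nonneg (by linarith) _
      nlinarith) n
    rw [← sub_eq_add_neg] at hb
    linarith
  have h2 : (edgeLaw n p q).real (N'ᶜ) = (edgeLaw n p q).real (Nᶜ) :=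
    edgeLaw_real_comp_swap p q fun ω => ¬ NoZeroRow ω
  have h3 : (edgeLaw n p q).real ((N ∩ N')ᶜ) ≤
      (edgeLaw n p q).real (Nᶜ) + (edgeLaw n p q).real (N'ᶜ) := by
    rw [Set.compl_inter]
    exact measureReal_union_le _ _
  rw [probReal_compl_eq_one_sub (hmeas _)] at h3
  change 1 - (edgeLaw n p q).real (N ∩ N') ≤ _
  linarith

end Decomposition

/-! ### Elementary symmetric functions -/

section SymmetricBound

/-- Two terms of the binomial expansion: exactly what adjoining one variable to an elementary
symmetric function requires. -/
theorem pow_succ_add_mul_le_add_pow {x y : ℝ} (hx : 0 ≤ x) (hy : 0 ≤ y) (k : ℕ) :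
    x ^ (k + 1) + (k + 1) * y * x ^ k ≤ (x + y) ^ (k + 1) := by
  induction k with
  | zero => simp
  | succ k ih =>
    have h1 : 0 ≤ (k + 1 : ℝ) * y * x ^ k * y := by positivity
    calc x ^ (k + 1 + 1) + ((k + 1 : ℕ) + 1) * y * x ^ (k + 1)
        ≤ (x ^ (k + 1) + (k + 1) * y * x ^ k) * (x + y) := by
          push_cast
          ring_nf at h1 ⊢
          nlinarith
      _ ≤ (x + y) ^ (k + 1) * (x + y) := by gcongr
      _ = (x + y) ^ (k + 1 + 1) := by ring

/-- An elementary symmetric function of nonnegative reals is at most `(∑ v) ^ k / k!`. -/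
theorem factorial_mul_sum_powersetCard_prod_le {ι : Type*} [DecidableEq ι] (U : Finset ι)
    (v : ι → ℝ) (hv : ∀ j, 0 ≤ v j) (k : ℕ) :
    (k.factorial : ℝ) * ∑ T ∈ U.powersetCard k, ∏ j ∈ T, v j ≤ (∑ j ∈ U, v j) ^ k := by
  induction U using Finset.induction_on generalizing k with
  | empty =>
    cases k with
    | zero => simp
    | succ k => simp [Finset.powersetCard_eq_empty.2 (show (∅ : Finset ι).card < k + 1 by simp)]
  | insert a U ha ih =>
    cases k with
    | zero => simp
    | succ k =>
      rw [Finset.powersetCard_succ_insert ha, Finset.sum_union, Finset.sum_image]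
      · have h1 : ∑ T ∈ U.powersetCard k, ∏ j ∈ insert a T, v j =
            v a * ∑ T ∈ U.powersetCard k, ∏ j ∈ T, v j := by
          rw [Finset.mul_sum]
          refine Finset.sum_congr rfl fun T hT => ?_
          rw [Finset.prod_insert fun h => ha ((Finset.mem_powersetCard.1 hT).1 h)]
        have hS : 0 ≤ ∑ j ∈ U, v j := Finset.sum_nonneg fun j _ => hv j
        rw [h1, Finset.sum_insert ha, add_comm (v a)]
        refine le_trans ?_ (pow_succ_add_mul_le_add_pow hS (hv a) k)
        have h2 := ih (k + 1)
        have h3 := mul_le_mul_of_nonneg_left (ih k)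
          (mul_nonneg (by positivity : (0 : ℝ) ≤ k + 1) (hv a))
        rw [Nat.factorial_succ] at h2 ⊢
        push_cast at h2 ⊢
        nlinarith
      · intro T hT T' hT' h
        have h1 : a ∉ T := fun h => ha ((Finset.mem_powersetCard.1 hT).1 h)
        have h2 : a ∉ T' := fun h => ha ((Finset.mem_powersetCard.1 hT').1 h)
        rw [← Finset.erase_insert h1, ← Finset.erase_insert h2, h]
      · rw [Finset.disjoint_left]
        intro T hT hT'
        obtain ⟨T', _, rfl⟩ := Finset.mem_image.1 hT'
        exact ha ((Finset.mem_powersetCard.1 hT).1 (Finset.mem_insert_self _ _))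

end SymmetricBound

/-! ### First moment bound for sparse sets -/

section UnionBound

variable {n : ℕ} (p q : I)

/-- The off-diagonal pairs with first entry in `S` and second entry outside `T`. -/
def offDiagAbsent (S T : Finset (Fin n)) : Finset (Fin n × Fin n) :=
  (S ×ˢ Tᶜ).filter fun e => e.1 ≠ e.2

/-- Of the `S.card * (n - S.card + 1)` pairs in `S ×ˢ Tᶜ`, at most `S.card` are loops. Loops are
discarded because `1 - q` may be as large as 1. -/
theorem le_card_offDiagAbsent {S T : Finset (Fin n)} (h : T.card + 1 = S.card) :
    S.card * (n - S.card) ≤ (offDiagAbsent S T).card := by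
  have h1 : ((S ×ˢ Tᶜ).filter fun e : Fin n × Fin n => ¬ e.1 ≠ e.2).card ≤ S.card := by
    refine Finset.card_le_card_of_injOn Prod.fst ?_ ?_
    · intro e he
      simp only [Finset.coe_filter, Finset.mem_product, Set.mem_ofPred_eq] at he
      exact he.1.1
    · rintro ⟨a, b⟩ he ⟨a', b'⟩ he' heq
      simp only [Finset.coe_filter, Finset.mem_product, Set.mem_ofPred_eq, not_not] at he he' heq
      have := he.2
      have := he'.2
      simp_all
  have h2 := Finset.card_filter_add_card_filter_not (s := S ×ˢ Tᶜ)
    (fun e : Fin n × Fin n => e.1 ≠ e.2)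
  rw [Finset.card_product, Finset.card_compl, Fintype.card_fin] at h2
  have h3 : S.card ≤ n := by simpa using Finset.card_le_univ S
  have h4 : n - T.card = (n - S.card) + 1 := by omega
  rw [h4, mul_add, mul_one] at h2
  rw [offDiagAbsent]
  omega

/-- The sets of off-diagonal edges from `S` into `j`, given by their sources, one of which must be
present if `j` has two neighbours in `S`. -/
def sourceChoices (S T : Finset (Fin n)) (j : Fin n) : Finset (Finset (Fin n)) :=
  if j ∈ T then (if j ∈ S then (S.erase j).powersetCard 1 else S.powersetCard 2) else {∅}

/-- A bound for the probability that `j` has two neighbours in `S`. -/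
noncomputable def columnWeight (p : I) (S : Finset (Fin n)) (j : Fin n) : ℝ :=
  if j ∈ S then S.card * p else S.card ^ 2 * p ^ 2 / 2

theorem columnWeight_nonneg (S : Finset (Fin n)) (j : Fin n) : 0 ≤ columnWeight p S j := by
  have := p.2.1
  unfold columnWeight
  split_ifs <;> positivity

/-- A column in `S` may have its own loop as one of its two neighbours, so it carries only one
factor `p`; this is affordable because there are just `S.card` such columns. -/
theorem sum_columnWeight_le (S : Finset (Fin n)) :
    ∑ j, columnWeight p S j ≤ (S.card : ℝ) ^ 2 * (p + n * p ^ 2 / 2) := by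
  have hp := p.2.1
  classical
  rw [← Finset.sum_sdiff (Finset.subset_univ S)]
  have h1 : ∑ j ∈ Finset.univ \ S, columnWeight p S j ≤ n * ((S.card : ℝ) ^ 2 * p ^ 2 / 2) := by
    have h : ∀ j ∈ Finset.univ \ S, columnWeight p S j = (S.card : ℝ) ^ 2 * p ^ 2 / 2 :=
      fun j hj => if_neg (Finset.mem_sdiff.1 hj).2
    rw [Finset.sum_congr rfl h, Finset.sum_const, nsmul_eq_mul]
    gcongr
    exact (Finset.card_le_univ _).trans_eq (Fintype.card_fin n)
  have h2 : ∑ j ∈ S, columnWeight p S j = S.card * (S.card * p) := by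
    have h : ∀ j ∈ S, columnWeight p S j = S.card * p := fun j hj => if_pos hj
    rw [Finset.sum_congr rfl h, Finset.sum_const, nsmul_eq_mul]
  rw [h2]
  linarith

theorem sum_sourceChoices_le {S T : Finset (Fin n)} (j : Fin n) :
    ∑ c ∈ sourceChoices S T j, (p : ℝ) ^ c.card ≤ if j ∈ T then columnWeight p S j else 1 := by
  have hp := p.2.1
  have hsum : ∀ (R : Finset (Fin n)) (k : ℕ), ∑ c ∈ R.powersetCard k, (p : ℝ) ^ c.card =
      R.card.choose k * (p : ℝ) ^ k := by
    intro R k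
    rw [Finset.sum_congr rfl fun c hc => by rw [(Finset.mem_powersetCard.1 hc).2],
      Finset.sum_const, Finset.card_powersetCard, nsmul_eq_mul]
  unfold sourceChoices columnWeight
  split_ifs with hT hS
  · rw [hsum, Nat.choose_one_right, pow_one]
    gcongr
    exact Finset.erase_subset _ _
  · rw [hsum]
    have h := Nat.choose_le_pow_div (α := ℝ) 2 S.card
    rw [Nat.factorial_two] at h
    push_cast at h
    calc (S.card.choose 2 : ℝ) * (p : ℝ) ^ 2 ≤ (S.card ^ 2 / 2) * (p : ℝ) ^ 2 := by gcongr
      _ = _ := by ring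
  · simp

/-- The first moment bound for one pair `(S, T)` in `HasSparseSet`. -/
theorem edgeLaw_real_sparse_pair_le (S T : Finset (Fin n)) (hST : T.card + 1 = S.card) :
    (edgeLaw n p q).real {ω | (∀ i ∈ S, ∀ j ∉ T, ¬ ω (i, j) = true) ∧
      ∀ j ∈ T, ∃ i ∈ S, ∃ i' ∈ S, i ≠ i' ∧ ω (i, j) = true ∧ ω (i', j) = true} ≤
      (1 - p : ℝ) ^ (S.card * (n - S.card)) * ∏ j ∈ T, columnWeight p S j := by
  classical
  have hp := p.2.1
  have hp' : (0 : ℝ) ≤ 1 - p := by linarith [p.2.2]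
  set A := offDiagAbsent S T
  let B : (Fin n → Finset (Fin n)) → Finset (Fin n × Fin n) :=
    fun f => Finset.univ.filter fun e => e.1 ∈ f e.2
  have hmem : ∀ f ∈ Fintype.piFinset (sourceChoices S T), ∀ i j, i ∈ f j →
      j ∈ T ∧ i ≠ j := by
    intro f hf i j hij
    have hfj := Fintype.mem_piFinset.1 hf j
    unfold sourceChoices at hfj
    split_ifs at hfj with hT hS
    · have := (Finset.mem_powersetCard.1 hfj).1 hij
      exact ⟨hT, Finset.ne_of_mem_erase this⟩
    · have := (Finset.mem_powersetCard.1 hfj).1 hij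
      exact ⟨hT, fun h => hS (h ▸ this)⟩
    · rw [Finset.mem_singleton.1 hfj] at hij
      simp at hij
  have hsub : {ω : Fin n × Fin n → Bool | (∀ i ∈ S, ∀ j ∉ T, ¬ ω (i, j) = true) ∧
      ∀ j ∈ T, ∃ i ∈ S, ∃ i' ∈ S, i ≠ i' ∧ ω (i, j) = true ∧ ω (i', j) = true} ⊆
      ⋃ f ∈ Fintype.piFinset (sourceChoices S T),
        {ω | (∀ e ∈ A, ω e = false) ∧ ∀ e ∈ B f, ω e = true} := by
    rintro ω ⟨h1, h2⟩
    have hch : ∀ j, ∃ c ∈ sourceChoices S T j, ∀ i ∈ c, ω (i, j) = true := by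
      intro j
      unfold sourceChoices
      split_ifs with hT hS
      · obtain ⟨i, hi, i', hi', hne, hij, hij'⟩ := h2 j hT
        -- At most one of the two neighbours is `j` itself; the other gives an off-diagonal edge.
        rcases ne_or_eq i j with h | h
        · exact ⟨{i}, by simp [hi, h], by simpa using hij⟩
        · exact ⟨{i'}, by simp [hi', h ▸ hne.symm], by simpa using hij'⟩
      · obtain ⟨i, hi, i', hi', hne, hij, hij'⟩ := h2 j hT
        refine ⟨{i, i'}, Finset.mem_powersetCard.2 ⟨?_, Finset.card_pair hne⟩, by simp [hij, hij']⟩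
        intro x hx
        rcases Finset.mem_insert.1 hx with rfl | hx
        · exact hi
        · rwa [Finset.mem_singleton.1 hx]
      · exact ⟨∅, by simp, by simp⟩
    choose f hf hfω using hch
    simp only [Set.mem_iUnion]
    refine ⟨f, Fintype.mem_piFinset.2 hf, ?_, ?_⟩
    · rintro ⟨i, j⟩ he
      simp only [A, offDiagAbsent, Finset.mem_filter, Finset.mem_product,
        Finset.mem_compl] at he
      simpa using h1 i he.1.1 j he.1.2
    · rintro ⟨i, j⟩ he
      simp only [B, Finset.mem_filter, Finset.mem_univ, true_and] at he
      exact hfω j i he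
  refine (measureReal_mono hsub (measure_ne_top _ _)).trans ((measureReal_biUnion_finset_le _ _).trans ?_)
  have hcyl : ∀ f ∈ Fintype.piFinset (sourceChoices S T),
      (edgeLaw n p q).real {ω | (∀ e ∈ A, ω e = false) ∧ ∀ e ∈ B f, ω e = true} =
        (1 - p : ℝ) ^ A.card * ∏ j, (p : ℝ) ^ (f j).card := by
    intro f hf
    rw [edgeLaw_real_absent_present]
    · congr 1
      · rw [← Finset.prod_const]
        refine Finset.prod_congr rfl fun e he => ?_
        have : e.1 ≠ e.2 := (Finset.mem_filter.1 he).2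
        simp [edgeProb, this]
      · rw [Finset.prod_filter, Fintype.prod_prod_type_right]
        refine Finset.prod_congr rfl fun j _ => ?_
        rw [← Finset.prod_filter]
        change ∏ i with i ∈ f j, (edgeProb p q (i, j) : ℝ) = _
        rw [Finset.filter_univ_mem, ← Finset.prod_const]
        refine Finset.prod_congr rfl fun i hi => ?_
        simp [edgeProb, (hmem f hf i j hi).2]
    · rw [Finset.disjoint_left]
      rintro ⟨i, j⟩ he he'
      simp only [A, offDiagAbsent, Finset.mem_filter, Finset.mem_product,
        Finset.mem_compl] at he
      simp only [B, Finset.mem_filter, Finset.mem_univ, true_and] at he'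
      exact he.1.2 (hmem f hf i j he').1
  -- The sum over all choice functions factors into a product over columns of sums over the choices
  -- in each column.
  rw [Finset.sum_congr rfl hcyl, ← Finset.mul_sum,
    ← Finset.prod_univ_sum (sourceChoices S T) fun _ c => (p : ℝ) ^ c.card]
  have hprod : ∏ j, ∑ c ∈ sourceChoices S T j, (p : ℝ) ^ c.card ≤
      ∏ j ∈ T, columnWeight p S j := by
    calc _ ≤ ∏ j, if j ∈ T then columnWeight p S j else 1 :=
          Finset.prod_le_prod (fun j _ => Finset.sum_nonneg fun c _ => by positivity)
            fun j _ => sum_sourceChoices_le p j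
      _ = _ := by simp
  have hpow : (1 - p : ℝ) ^ A.card ≤ (1 - p : ℝ) ^ (S.card * (n - S.card)) :=
    pow_le_pow_of_le_one hp' (by linarith) (le_card_offDiagAbsent hST)
  gcongr

/-- Union bound over `S` and `T`; the sum over `T` of products of column weights is an elementary
symmetric function, whence the power over `(s - 1)!`. -/
theorem edgeLaw_real_hasSparseRows_le :
    (edgeLaw n p q).real {ω | HasSparseRows ω} ≤
      ∑ s ∈ Finset.Icc 2 ((n + 1) / 2), (n.choose s : ℝ) *
        (((s : ℝ) ^ 2 * (p + n * p ^ 2 / 2)) ^ (s - 1) / (s - 1).factorial *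
          (1 - p : ℝ) ^ (s * (n - s))) := by
  classical
  have hp := p.2.1
  have hp' : (0 : ℝ) ≤ 1 - p := by linarith [p.2.2]
  let E : Finset (Fin n) → Finset (Fin n) → Set (Fin n × Fin n → Bool) := fun S T =>
    {ω | (∀ i ∈ S, ∀ j ∉ T, ¬ ω (i, j) = true) ∧
      ∀ j ∈ T, ∃ i ∈ S, ∃ i' ∈ S, i ≠ i' ∧ ω (i, j) = true ∧ ω (i', j) = true}
  have hsub : {ω : Fin n × Fin n → Bool | HasSparseRows ω} ⊆
      ⋃ s ∈ Finset.Icc 2 ((n + 1) / 2), ⋃ S ∈ (Finset.univ : Finset (Fin n)).powersetCard s,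
        ⋃ T ∈ (Finset.univ : Finset (Fin n)).powersetCard (s - 1), E S T := by
    rintro ω ⟨S, T, h2, hn, hT, h⟩
    rw [Fintype.card_fin] at hn
    simp only [Set.mem_iUnion]
    exact ⟨S.card, Finset.mem_Icc.2 ⟨h2, by omega⟩, S, by simp, T,
      Finset.mem_powersetCard.2 ⟨Finset.subset_univ _, by omega⟩, h⟩
  refine (measureReal_mono hsub (measure_ne_top _ _)).trans ((measureReal_biUnion_finset_le _ _).trans ?_)
  refine Finset.sum_le_sum fun s hs => (measureReal_biUnion_finset_le _ _).trans ?_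
  have hs2 := (Finset.mem_Icc.1 hs).1
  have hS : ∀ S ∈ (Finset.univ : Finset (Fin n)).powersetCard s, (edgeLaw n p q).real
      (⋃ T ∈ (Finset.univ : Finset (Fin n)).powersetCard (s - 1), E S T) ≤
      ((s : ℝ) ^ 2 * (p + n * p ^ 2 / 2)) ^ (s - 1) / (s - 1).factorial *
          (1 - p : ℝ) ^ (s * (n - s)) := by
    intro S hS
    have hSs := (Finset.mem_powersetCard.1 hS).2
    refine (measureReal_biUnion_finset_le _ _).trans ?_
    have h1 : ∑ T ∈ (Finset.univ : Finset (Fin n)).powersetCard (s - 1),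
        (edgeLaw n p q).real (E S T) ≤
        ∑ T ∈ (Finset.univ : Finset (Fin n)).powersetCard (s - 1),
          (1 - p : ℝ) ^ (s * (n - s)) * ∏ j ∈ T, columnWeight p S j := by
      refine Finset.sum_le_sum fun T hT => ?_
      have hTs := (Finset.mem_powersetCard.1 hT).2
      rw [← hSs]
      exact edgeLaw_real_sparse_pair_le p q S T (by omega)
    refine h1.trans ?_
    rw [← Finset.mul_sum, mul_comm]
    gcongr
    rw [le_div_iff₀' (by positivity)]
    refine (factorial_mul_sum_powersetCard_prod_le _ _ (columnWeight_nonneg p S) _).trans ?_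
    gcongr
    · exact Finset.sum_nonneg fun j _ => columnWeight_nonneg p S j
    · rw [← hSs]
      exact sum_columnWeight_le p S
  refine (Finset.sum_le_card_nsmul _ _ _ hS).trans ?_
  rw [Finset.card_powersetCard, Finset.card_univ, Fintype.card_fin, nsmul_eq_mul]

end UnionBound

/-! ### The bound in terms of the expected degree -/

section SimplifiedBound

variable {n : ℕ} (p q : I)

/-- From `n.choose s ≤ n ^ s / s!` and `s! = s * (s - 1)!`, the powers of `s` gather into the square
of `s ^ (s - 1) / (s - 1)! ≤ exp s`; hence `exp 2` per unit of `s`. -/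
theorem choose_mul_pow_div_factorial_le {s : ℕ} (hs : 1 ≤ s) (hn : 0 < n) {K : ℝ} (hK : 1 ≤ K) :
    (n.choose s : ℝ) * (((s : ℝ) ^ 2 * (K / n)) ^ (s - 1) / (s - 1).factorial) ≤
      n * (Real.exp 2 * K) ^ s := by
  obtain ⟨t, rfl⟩ : ∃ t, s = t + 1 := ⟨s - 1, by omega⟩
  have hn' : (0 : ℝ) < n := by exact_mod_cast hn
  have h1 := Nat.choose_le_pow_div (α := ℝ) (t + 1) n
  have h2 := Real.pow_div_factorial_le_exp (x := ((t + 1 : ℕ) : ℝ)) (by positivity) t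
  have h3 : (0 : ℝ) < t.factorial := by positivity
  rw [Nat.add_sub_cancel]
  set x : ℝ := ((t + 1 : ℕ) : ℝ) with hx
  have hx1 : 1 ≤ x := by rw [hx]; push_cast; linarith [(Nat.cast_nonneg t : (0 : ℝ) ≤ t)]
  have hfac : ((t + 1).factorial : ℝ) = x * t.factorial := by
    rw [Nat.factorial_succ]; push_cast; rw [hx]; push_cast; ring
  rw [hfac] at h1
  calc (n.choose (t + 1) : ℝ) * ((x ^ 2 * (K / n)) ^ t / t.factorial)
      ≤ ((n : ℝ) ^ (t + 1) / (x * t.factorial)) * ((x ^ 2 * (K / n)) ^ t / t.factorial) := by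
        gcongr
    _ = (n * K ^ t * (x ^ t / t.factorial) ^ 2) / x := by
        rw [mul_pow, div_pow, ← pow_mul, mul_comm 2 t, pow_mul, pow_succ (n : ℝ)]
        field_simp
    _ ≤ n * K ^ t * (x ^ t / t.factorial) ^ 2 := div_le_self (by positivity) hx1
    _ ≤ n * K ^ (t + 1) * (Real.exp x) ^ 2 := by
        gcongr
        · omega
    _ = n * (Real.exp 2 * K) ^ (t + 1) := by
        rw [mul_pow, ← Real.exp_nat_mul, ← Real.exp_nat_mul, hx]
        push_cast
        ring_nf

/-- The first moment bound in terms of the expected degree `n * p`. -/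
theorem edgeLaw_real_hasSparseRows_le_sum {K : ℝ} (hK : 1 ≤ K)
    (hKp : n * (p : ℝ) + (n * p) ^ 2 / 2 ≤ K) :
    (edgeLaw n p q).real {ω | HasSparseRows ω} ≤
      ∑ s ∈ Finset.Icc 2 ((n + 1) / 2),
        n * (Real.exp 2 * K * Real.exp (-(p * (n - s)))) ^ s := by
  have hp := p.2.1
  have hp' : (0 : ℝ) ≤ 1 - p := by linarith [p.2.2]
  refine (edgeLaw_real_hasSparseRows_le p q).trans (Finset.sum_le_sum fun s hs => ?_)
  obtain ⟨hs2, hsn⟩ := Finset.mem_Icc.1 hs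
  have hn : 0 < n := by omega
  have hn' : (0 : ℝ) < n := by exact_mod_cast hn
  have hsn' : s ≤ n := by omega
  have hexp : (1 - p : ℝ) ^ (s * (n - s)) ≤ Real.exp (-(p * (n - s))) ^ s := by
    rw [mul_comm s, pow_mul]
    gcongr
    calc (1 - p : ℝ) ^ (n - s) ≤ Real.exp (-p) ^ (n - s) := by
          gcongr
          exact Real.one_sub_le_exp_neg _
      _ = _ := by
          rw [← Real.exp_nat_mul, Nat.cast_sub hsn']
          ring_nf
  have hK' : (p : ℝ) + n * p ^ 2 / 2 ≤ K / n := by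
    rw [le_div_iff₀ hn']
    linarith
  rw [mul_pow _ (Real.exp _), ← mul_assoc, ← mul_assoc]
  refine mul_le_mul (le_trans ?_ (choose_mul_pow_div_factorial_le (s := s) (by omega) hn hK))
    hexp (by positivity) (by positivity)
  gcongr

end SimplifiedBound

/-! ### Sparse sets disappear -/

section Sparse

/-- Splitting off the first term of the first moment bound and bounding the rest by a geometric
series. -/
theorem sum_sparse_bound_le {n : ℕ} {p L : ℝ} (hp : 0 ≤ p) (hp1 : p ≤ 1) (hL : L = n * p)
    (hy : Real.exp 3 * L ^ 2 * Real.exp (-(L / 2)) ≤ 1 / 2) :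
    ∑ s ∈ Finset.Icc 2 ((n + 1) / 2),
        n * (Real.exp 2 * L ^ 2 * Real.exp (-(p * (n - s)))) ^ s ≤
      n * (Real.exp 4 * L ^ 2 * Real.exp (-L)) ^ 2 +
        2 * (n * (Real.exp 3 * L ^ 2 * Real.exp (-(L / 2))) ^ 3) := by
  set y := Real.exp 3 * L ^ 2 * Real.exp (-(L / 2)) with hy_def
  have hy0 : 0 ≤ y := by positivity
  -- For `s ≥ 3` the crude decay `exp (-(L / 2))` from `s ≤ (n + 1) / 2` suffices. For `s = 2` it
  -- would only balance the factor `n`, so that term keeps the full `exp (-L)`.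
  have hsub : Finset.Icc 2 ((n + 1) / 2) ⊆ insert 2 (Finset.Ico 3 ((n + 1) / 2 + 1)) := by
    intro s hs
    simp only [Finset.mem_insert, Finset.mem_Ico, Finset.mem_Icc] at hs ⊢
    omega
  refine (Finset.sum_le_sum_of_subset_of_nonneg hsub fun _ _ _ => by positivity).trans ?_
  rw [Finset.sum_insert (by simp)]
  gcongr ?_ + ?_
  · refine mul_le_mul_of_nonneg_left (pow_le_pow_left₀ (by positivity) ?_ 2) (by positivity)
    rw [show (4 : ℝ) = 2 + 2 by norm_num, Real.exp_add, hL]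
    have h1 : Real.exp (-(p * (n - (2 : ℕ)))) ≤ Real.exp 2 * Real.exp (-(n * p)) := by
      rw [← Real.exp_add]
      apply Real.exp_le_exp.2
      push_cast
      linarith
    calc Real.exp 2 * (n * p) ^ 2 * Real.exp (-(p * (n - (2 : ℕ))))
        ≤ Real.exp 2 * (n * p) ^ 2 * (Real.exp 2 * Real.exp (-(n * p))) := by gcongr
      _ = _ := by ring
  · have hterm : ∀ s ∈ Finset.Ico 3 ((n + 1) / 2 + 1),
        (n : ℝ) * (Real.exp 2 * L ^ 2 * Real.exp (-(p * (n - s)))) ^ s ≤ n * y ^ s := by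
      intro s hs
      have hs' : 2 * s ≤ n + 1 := by
        have := (Finset.mem_Ico.1 hs).2
        omega
      have hs'' : 2 * (s : ℝ) ≤ n + 1 := by exact_mod_cast hs'
      gcongr
      rw [hy_def, show (3 : ℝ) = 2 + 1 by norm_num, Real.exp_add]
      have h1 : Real.exp (-(p * (n - s))) ≤ Real.exp 1 * Real.exp (-(L / 2)) := by
        rw [← Real.exp_add]
        apply Real.exp_le_exp.2
        rw [hL]
        nlinarith
      calc Real.exp 2 * L ^ 2 * Real.exp (-(p * (n - s)))
          ≤ Real.exp 2 * L ^ 2 * (Real.exp 1 * Real.exp (-(L / 2))) := by gcongr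
        _ = _ := by ring
    refine (Finset.sum_le_sum hterm).trans ?_
    rw [← Finset.mul_sum]
    have h := geom_sum_Ico_le_of_lt_one (m := 3) (n := (n + 1) / 2 + 1) hy0 (by linarith)
    have h2 : y ^ 3 / (1 - y) ≤ 2 * y ^ 3 := by
      rw [div_le_iff₀ (by linarith)]
      have := pow_nonneg hy0 3
      nlinarith
    calc (n : ℝ) * ∑ s ∈ Finset.Ico 3 ((n + 1) / 2 + 1), y ^ s ≤ n * (2 * y ^ 3) := by
          gcongr
          exact h.trans h2
      _ = 2 * (n * y ^ 3) := by ring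

/-- Obstructions other than isolated vertices disappear as soon as the expected degree is at least
`log n - M`. -/
theorem tendsto_hasSparseRows (p q : ℕ → I) (M : ℝ)
    (h : ∀ᶠ n : ℕ in atTop, Real.log n - M ≤ n * (p n : ℝ)) :
    Tendsto (fun n => (edgeLaw n (p n) (q n)).real {ω | HasSparseRows ω}) atTop (𝓝 0) := by
  set L : ℕ → ℝ := fun n => n * (p n : ℝ) with hLdef
  have hL : Tendsto L atTop atTop := by
    refine tendsto_atTop_mono' _ h ?_
    exact tendsto_atTop_add_const_right _ (-M)
      (Real.tendsto_log_atTop.comp tendsto_natCast_atTop_atTop)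
  have hL2 : Tendsto (fun n => L n / 2) atTop atTop := hL.atTop_div_const (by norm_num)
  have hy : Tendsto (fun n => Real.exp 3 * L n ^ 2 * Real.exp (-(L n / 2))) atTop (𝓝 0) := by
    have := ((Real.tendsto_pow_mul_exp_neg_atTop_nhds_zero 2).comp hL2).const_mul
      (Real.exp 3 * 4)
    rw [mul_zero] at this
    refine this.congr fun n => ?_
    simp only [Function.comp]
    ring
  -- The two parts of `sum_sparse_bound_le` after replacing `n` by `exp M * exp L`; `64 = 2 ^ 6`
  -- comes from writing `L ^ 6` through `L / 2`.
  set b : ℕ → ℝ := fun n => Real.exp M * (Real.exp 8 * (L n ^ 4 * Real.exp (-L n)) +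
    2 * (64 * Real.exp 9 * ((L n / 2) ^ 6 * Real.exp (-(L n / 2))))) with hb
  have hb0 : Tendsto b atTop (𝓝 0) := by
    have h1 := ((Real.tendsto_pow_mul_exp_neg_atTop_nhds_zero 4).comp hL).const_mul (Real.exp 8)
    have h2 := (((Real.tendsto_pow_mul_exp_neg_atTop_nhds_zero 6).comp hL2).const_mul
      (64 * Real.exp 9)).const_mul 2
    simpa using (h1.add h2).const_mul (Real.exp M)
  refine squeeze_zero' (Eventually.of_forall fun n => measureReal_nonneg) ?_ hb0
  filter_upwards [h, hL.eventually_ge_atTop 2, hy.eventually_le_const (by norm_num : (0:ℝ) < 1 / 2),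
    eventually_gt_atTop 0] with n hn hn2 hny hn0
  have hn0' : (0 : ℝ) < n := by exact_mod_cast hn0
  have hnL : (n : ℝ) ≤ Real.exp M * Real.exp (L n) := by
    rw [← Real.exp_add, ← Real.log_le_iff_le_exp hn0']
    linarith
  -- `K = L ^ 2` is admissible since `L + L ^ 2 / 2 ≤ L ^ 2` once `L ≥ 2`.
  refine (edgeLaw_real_hasSparseRows_le_sum (p n) (q n) (K := L n ^ 2) (by nlinarith) ?_).trans ?_
  · change L n + L n ^ 2 / 2 ≤ L n ^ 2
    nlinarith
  refine (sum_sparse_bound_le (p n).2.1 (p n).2.2 rfl hny).trans ?_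
  have e1 : Real.exp 8 = Real.exp 4 ^ 2 := by rw [← Real.exp_nat_mul]; norm_num
  have e2 : Real.exp 9 = Real.exp 3 ^ 3 := by rw [← Real.exp_nat_mul]; norm_num
  have e3 : Real.exp (L n) * Real.exp (-L n) = 1 := by rw [← Real.exp_add]; simp
  have e4 : Real.exp (-L n) = Real.exp (-(L n / 2)) ^ 2 := by
    rw [← Real.exp_nat_mul]; push_cast; ring_nf
  have e5 : Real.exp (L n) * Real.exp (-(L n / 2)) ^ 2 = 1 := by rw [← e4, e3]
  calc (n : ℝ) * (Real.exp 4 * L n ^ 2 * Real.exp (-L n)) ^ 2 +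
        2 * (n * (Real.exp 3 * L n ^ 2 * Real.exp (-(L n / 2))) ^ 3)
      ≤ (Real.exp M * Real.exp (L n)) * (Real.exp 4 * L n ^ 2 * Real.exp (-L n)) ^ 2 +
        2 * ((Real.exp M * Real.exp (L n)) *
          (Real.exp 3 * L n ^ 2 * Real.exp (-(L n / 2))) ^ 3) := by gcongr
    _ = Real.exp M * (Real.exp 4 ^ 2 * (L n ^ 4 * Real.exp (-L n)) *
          (Real.exp (L n) * Real.exp (-L n)) +
        2 * (64 * Real.exp 3 ^ 3 * ((L n / 2) ^ 6 * Real.exp (-(L n / 2))) *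
          (Real.exp (L n) * Real.exp (-(L n / 2)) ^ 2))) := by ring
    _ = b n := by rw [e3, e5, hb, e1, e2]; ring

end Sparse

/-! ### The two extreme regimes -/

section Isolated

variable (p q : ℕ → I) (c ε : ℕ → ℝ)

/-- The Hamiltonian decomposition probability differs from the probability of having no isolated
row or column by `o(1)`. -/
theorem tendsto_noZero_sub (M : ℝ) (h : ∀ᶠ n : ℕ in atTop, Real.log n - M ≤ n * (p n : ℝ)) :
    Tendsto (fun n => (gnpq n (p n) (q n)).real {G | HasHamiltonianDecomposition G} -
      (edgeLaw n (p n) (q n)).real {ω | NoZeroRow ω ∧ NoZeroRow (ω ∘ Prod.swap)})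
      atTop (𝓝 0) := by
  have h0 := (tendsto_hasSparseRows p q M h).const_mul (-2)
  rw [mul_zero] at h0
  refine tendsto_of_tendsto_of_tendsto_of_le_of_le h0 tendsto_const_nhds ?_ ?_
  · intro n
    have := edgeLaw_real_noZero_le (n := n) (p n) (q n)
    simp only
    linarith
  · intro n
    have := gnpq_real_hasHamiltonianDecomposition_le (n := n) (p n) (q n)
    simp only
    linarith

variable {p q c ε}
  (hp : ∀ᶠ n : ℕ in atTop, (p n : ℝ) = (Real.log n + c n + ε n) / n)
include hp

theorem eventually_mul_eq : ∀ᶠ n : ℕ in atTop, n * (p n : ℝ) = Real.log n + c n + ε n := by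
  filter_upwards [hp, eventually_gt_atTop 0] with n hn hn0
  rw [hn]
  field_simp

/-- The expected number of zero rows and columns is at most `2 * exp 1 * exp (-(c + ε))`; the factor
`exp 1` absorbs the exponent `n - 1` in place of `n`. -/
theorem tendsto_hamiltonian_one (hε : Tendsto ε atTop (𝓝 0)) (hc : Tendsto c atTop atTop) :
    Tendsto (fun n => (gnpq n (p n) (q n)).real {G | HasHamiltonianDecomposition G})
      atTop (𝓝 1) := by
  have hcε : Tendsto (fun n => c n + ε n) atTop atTop := hc.atTop_add hε
  have hL := eventually_mul_eq hp
  have h1 := tendsto_noZero_sub p q 0 (by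
    filter_upwards [hL, hcε.eventually_ge_atTop 0] with n hn hn'
    linarith)
  have h2 : Tendsto (fun n => 1 - (edgeLaw n (p n) (q n)).real
      {ω | NoZeroRow ω ∧ NoZeroRow (ω ∘ Prod.swap)}) atTop (𝓝 0) := by
    have h3 : Tendsto (fun n => 2 * Real.exp 1 * Real.exp (-(c n + ε n))) atTop (𝓝 0) := by
      simpa using (Real.tendsto_exp_neg_atTop_nhds_zero.comp hcε).const_mul (2 * Real.exp 1)
    refine squeeze_zero' (Eventually.of_forall fun n => by
      have : (edgeLaw n (p n) (q n)).real
        {ω | NoZeroRow ω ∧ NoZeroRow (ω ∘ Prod.swap)} ≤ 1 := measureReal_le_one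
      linarith) ?_ h3
    filter_upwards [hL, eventually_gt_atTop 0] with n hn hn0
    refine (one_sub_edgeLaw_real_noZero_le _ _).trans ?_
    rw [mul_assoc]
    have hn0' : (0 : ℝ) < n := by exact_mod_cast hn0
    have hp0 := (p n).2.1
    have hp1 := (p n).2.2
    have hq0 := (q n).2.1
    have hpow : (1 - p n : ℝ) ^ (n - 1) ≤ Real.exp (-(p n : ℝ)) ^ (n - 1) :=
      pow_le_pow_left₀ (by linarith) (Real.one_sub_le_exp_neg _) _
    rw [← Real.exp_nat_mul, Nat.cast_sub hn0] at hpow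
    have hnexp : (n : ℝ) = Real.exp (Real.log n) := (Real.exp_log hn0').symm
    have h4 : Real.exp (-(c n + ε n)) = n * Real.exp (-(n * p n)) := by
      calc Real.exp (-(c n + ε n)) = Real.exp (Real.log n + -(n * p n)) := by rw [hn]; ring_nf
        _ = _ := by rw [Real.exp_add, ← hnexp]
    have h5 : Real.exp (((n : ℝ) - (1 : ℕ)) * -(p n : ℝ)) ≤
        Real.exp 1 * Real.exp (-(n * p n)) := by
      rw [← Real.exp_add]
      apply Real.exp_le_exp.2
      push_cast
      linarith
    have h6 : (1 - q n : ℝ) * (1 - p n : ℝ) ^ (n - 1) ≤ 1 * (1 - p n : ℝ) ^ (n - 1) := by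
      exact mul_le_mul_of_nonneg_right (by linarith) (pow_nonneg (by linarith) _)
    calc (2 : ℝ) * (n * ((1 - q n : ℝ) * (1 - p n : ℝ) ^ (n - 1)))
        ≤ 2 * (n * (Real.exp 1 * Real.exp (-(n * p n)))) := by
          refine mul_le_mul_of_nonneg_left (mul_le_mul_of_nonneg_left ?_ hn0'.le) zero_le_two
          linarith
      _ = _ := by rw [h4]; ring
  simpa using (h1.sub h2).add_const 1

omit hp in
-- Uses `log (1 - x) ≥ -x / (1 - x) ≥ -x - 2 * x ^ 2`. It complements `1 - x ≤ exp (-x)`, with an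
-- error harmless when `n * x ^ 2` is small.
theorem exp_le_one_sub_pow {x : ℝ} (hx0 : 0 ≤ x) (hx : x ≤ 1 / 2) (n : ℕ) :
    Real.exp (-(n * x) - 2 * (n * x ^ 2)) ≤ (1 - x) ^ n := by
  have h1 : 0 < 1 - x := by linarith
  have h2 := Real.one_sub_inv_le_log_of_pos h1
  have h3 : -x - 2 * x ^ 2 ≤ 1 - (1 - x)⁻¹ := by
    have : 1 - (1 - x)⁻¹ = -x / (1 - x) := by field_simp; ring
    rw [this, le_div_iff₀ h1]
    nlinarith [mul_nonneg hx0 hx0, mul_nonneg (mul_nonneg hx0 hx0) (by linarith : 0 ≤ 1 / 2 - x)]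
  have h4 : Real.exp (-x - 2 * x ^ 2) ≤ 1 - x := by
    rw [← Real.le_log_iff_exp_le h1]
    linarith
  calc Real.exp (-(n * x) - 2 * (n * x ^ 2)) = Real.exp (-x - 2 * x ^ 2) ^ n := by
        rw [← Real.exp_nat_mul]
        ring_nf
    _ ≤ _ := by gcongr

/-- If `c` is bounded above then `p` and `n * p ^ 2` tend to zero. -/
theorem tendsto_mul_sq_zero {C : ℝ} (hC : ∀ᶠ n in atTop, c n + ε n ≤ C) :
    Tendsto (fun n : ℕ => n * (p n : ℝ) ^ 2) atTop (𝓝 0) ∧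
      Tendsto (fun n : ℕ => (p n : ℝ)) atTop (𝓝 0) := by
  have hlog : ∀ k : ℕ, Tendsto (fun n : ℕ => Real.log n ^ k / n) atTop (𝓝 0) := by
    intro k
    exact (Real.isLittleO_pow_log_id_atTop (n := k)).tendsto_div_nhds_zero.comp
      tendsto_natCast_atTop_atTop
  have hL := eventually_mul_eq hp
  have h2 : Tendsto (fun n : ℕ => n * (p n : ℝ) ^ 2) atTop (𝓝 0) := by
    have h3 := ((hlog 2).add ((hlog 1).const_mul (2 * C))).add ((hlog 0).const_mul (C ^ 2))
    simp only [mul_zero, add_zero] at h3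
    refine squeeze_zero' (Eventually.of_forall fun n => by positivity) ?_ h3
    filter_upwards [hL, hC, eventually_gt_atTop 0] with n hn hnC hn0
    have hn0' : (0 : ℝ) < n := by exact_mod_cast hn0
    have h4 : 0 ≤ n * (p n : ℝ) := mul_nonneg hn0'.le (p n).2.1
    have h5 : (n * (p n : ℝ)) ^ 2 ≤ (Real.log n + C) ^ 2 := by
      apply pow_le_pow_left₀ h4
      linarith
    calc n * (p n : ℝ) ^ 2 = (n * (p n : ℝ)) ^ 2 / n := by field_simp
      _ ≤ (Real.log n + C) ^ 2 / n := by gcongr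
      _ = _ := by ring
  refine ⟨h2, ?_⟩
  have h3 := (hlog 1).add ((hlog 0).const_mul C)
  simp only [mul_zero, add_zero] at h3
  refine squeeze_zero' (Eventually.of_forall fun n => (p n).2.1) ?_ h3
  filter_upwards [hL, hC, eventually_gt_atTop 0] with n hn hnC hn0
  have hn0' : (0 : ℝ) < n := by exact_mod_cast hn0
  calc (p n : ℝ) = (n * (p n : ℝ)) / n := by field_simp
    _ ≤ (Real.log n + C) / n := by
      gcongr
      linarith
    _ = _ := by ring

/-- Zero rows alone suffice: rows are independent, so the probability is at most `(1 - r) ^ n ≤ exp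
(-(n * r))`, with no second moment argument. -/
theorem tendsto_hamiltonian_zero (hε : Tendsto ε atTop (𝓝 0)) (hc : Tendsto c atTop atBot)
    (hq : Tendsto (fun n : ℕ => (1 - (q n : ℝ)) * Real.exp (-c n)) atTop atTop) :
    Tendsto (fun n => (gnpq n (p n) (q n)).real {G | HasHamiltonianDecomposition G})
      atTop (𝓝 0) := by
  have hcε : Tendsto (fun n => c n + ε n) atTop atBot := hc.atBot_add hε
  have hL := eventually_mul_eq hp
  obtain ⟨hsq, hp0⟩ := tendsto_mul_sq_zero hp (hcε.eventually_le_atBot 0)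
  have h1 : Tendsto (fun n => Real.exp (-(Real.exp (-3) *
      ((1 - (q n : ℝ)) * Real.exp (-c n))))) atTop (𝓝 0) :=
    Real.tendsto_exp_neg_atTop_nhds_zero.comp (hq.const_mul_atTop (Real.exp_pos _))
  refine squeeze_zero' (Eventually.of_forall fun n => measureReal_nonneg) ?_ h1
  filter_upwards [hL, hsq.eventually_le_const (by norm_num : (0 : ℝ) < 1),
    hp0.eventually_le_const (by norm_num : (0 : ℝ) < 1 / 2),
    hε.eventually_le_const (by norm_num : (0 : ℝ) < 1), eventually_gt_atTop 0]
    with n hn hn1 hn2 hn3 hn0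
  have hn0' : (0 : ℝ) < n := by exact_mod_cast hn0
  have hq1 : (0 : ℝ) ≤ 1 - q n := by linarith [(q n).2.2]
  have hp1 := (p n).2.1
  set r : ℝ := (1 - q n : ℝ) * (1 - p n) ^ (n - 1) with hr
  have hr1 : r ≤ 1 := by
    have : (1 - p n : ℝ) ^ (n - 1) ≤ 1 := pow_le_one₀ (by linarith) (by linarith)
    have h0 : (0 : ℝ) ≤ (1 - p n : ℝ) ^ (n - 1) := pow_nonneg (by linarith) _
    nlinarith [(q n).2.1]
  have hle : (gnpq n (p n) (q n)).real {G | HasHamiltonianDecomposition G} ≤ (1 - r) ^ n := by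
    rw [hr, ← edgeLaw_real_noZeroRow]
    exact (gnpq_real_hasHamiltonianDecomposition_le _ _).trans
      (measureReal_mono (fun ω h => h.1) (measure_ne_top _ _))
  have hexp : (1 - r) ^ n ≤ Real.exp (-(n * r)) := by
    calc (1 - r) ^ n ≤ Real.exp (-r) ^ n :=
          pow_le_pow_left₀ (by linarith) (Real.one_sub_le_exp_neg _) _
      _ = _ := by rw [← Real.exp_nat_mul]; ring_nf
  refine hle.trans (hexp.trans (Real.exp_le_exp.2 (neg_le_neg ?_)))
  have h5 := exp_le_one_sub_pow hp1 hn2 n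
  have h6 : (1 - p n : ℝ) ^ n ≤ (1 - p n : ℝ) ^ (n - 1) :=
    pow_le_pow_of_le_one (by linarith) (by linarith) (Nat.sub_le _ _)
  -- In `exp (-3)`, one unit pays for `ε ≤ 1` and two for `2 * n * p ^ 2 ≤ 2`.
  have h7 : Real.exp (-3) * Real.exp (-c n) ≤
      n * Real.exp (-(n * p n) - 2 * (n * (p n : ℝ) ^ 2)) := by
    have hnexp : (n : ℝ) = Real.exp (Real.log n) := (Real.exp_log hn0').symm
    calc Real.exp (-3) * Real.exp (-c n) = Real.exp (-3 - c n) := by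
          rw [← Real.exp_add]; ring_nf
      _ ≤ Real.exp (Real.log n + (-(n * p n) - 2 * (n * (p n : ℝ) ^ 2))) := by
          apply Real.exp_le_exp.2
          linarith
      _ = _ := by rw [Real.exp_add, ← hnexp]
  calc Real.exp (-3) * ((1 - (q n : ℝ)) * Real.exp (-c n))
      = (1 - (q n : ℝ)) * (Real.exp (-3) * Real.exp (-c n)) := by ring
    _ ≤ (1 - (q n : ℝ)) * (n * (1 - p n : ℝ) ^ (n - 1)) := by
        refine mul_le_mul_of_nonneg_left (h7.trans ?_) hq1
        exact mul_le_mul_of_nonneg_left (h5.trans h6) hn0'.le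
    _ = n * r := by rw [hr]; ring

end Isolated

/-! ### Poisson limit of the inclusion-exclusion sum -/

section Poisson

/-- The contribution of the sets of `b` columns to the inclusion-exclusion formula for the
probability of no zero row or column, where `u` and `v` are the probabilities that an off-diagonal
edge and a loop are absent. -/
noncomputable def inclExclTerm (u v : ℝ) (n b : ℕ) : ℝ :=
  (-1 : ℝ) ^ b * n.choose b *
    ((u ^ b - v * u ^ (n - 1)) ^ (n - b) * (v * u ^ (b - 1) - v * u ^ (n - 1)) ^ b)

theorem inclExclTerm_eq (u v : ℝ) {n b : ℕ} (h : b + 1 ≤ n) :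
    inclExclTerm u v n b = ((-1) ^ b * v ^ b) *
      ((n.choose b * (u ^ (n - 1)) ^ b) * (1 - u ^ (n - b)) ^ b *
        (1 - v * u ^ (n - 1 - b)) ^ (n - b)) := by
  obtain ⟨m, rfl⟩ : ∃ m, n = m + b + 1 := ⟨n - (b + 1), by omega⟩
  have e1 : m + b + 1 - 1 = m + b := by omega
  have e2 : m + b + 1 - b = m + 1 := by omega
  have e3 : m + b - b = m := by omega
  rw [inclExclTerm, e1, e2, e3]
  cases b with
  | zero => simp
  | succ k =>
    have h1 : u ^ (k + 1) - v * u ^ (m + (k + 1)) = u ^ (k + 1) * (1 - v * u ^ m) := by ring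
    have h2 : v * u ^ (k + 1 - 1) - v * u ^ (m + (k + 1)) = v * (u ^ k * (1 - u ^ (m + 1))) := by
      rw [Nat.add_sub_cancel]; ring
    have h3 : (u ^ (m + (k + 1))) ^ (k + 1) = (u ^ (k + 1)) ^ (m + 1) * (u ^ k) ^ (k + 1) := by
      rw [← pow_mul, ← pow_mul, ← pow_mul, ← pow_add]
      ring_nf
    rw [h1, h2, h3, mul_pow, mul_pow, mul_pow]
    ring

/-- At `b = n` the last bracket is `v * u ^ (n - 1)` minus itself. The finite sum can thus be
treated as a series. -/
theorem inclExclTerm_eq_zero (u v : ℝ) {n b : ℕ} (hn : 0 < n) (h : n ≤ b) :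
    inclExclTerm u v n b = 0 := by
  rcases h.eq_or_lt with rfl | h
  · simp [inclExclTerm, hn.ne']
  · simp [inclExclTerm, Nat.choose_eq_zero_of_lt h]

theorem abs_inclExclTerm_le {u v : ℝ} (hu : 0 ≤ u) (hu1 : u ≤ 1) (hv : 0 ≤ v) (hv1 : v ≤ 1)
    {n : ℕ} (hn : 0 < n) (b : ℕ) :
    |inclExclTerm u v n b| ≤ (n * u ^ (n - 1)) ^ b / b.factorial := by
  rcases le_or_gt n b with h | h
  · rw [inclExclTerm_eq_zero u v hn h, abs_zero]
    positivity
  · rw [inclExclTerm_eq u v h]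
    have hpow : ∀ k, 0 ≤ 1 - u ^ k ∧ 1 - u ^ k ≤ 1 := fun k =>
      ⟨by linarith [pow_le_one₀ hu hu1 (n := k)], by linarith [pow_nonneg hu k]⟩
    have hvu : 0 ≤ 1 - v * u ^ (n - 1 - b) ∧ 1 - v * u ^ (n - 1 - b) ≤ 1 := by
      have h1 := mul_le_one₀ hv1 (pow_nonneg hu (n - 1 - b)) (pow_le_one₀ hu hu1)
      have h2 := mul_nonneg hv (pow_nonneg hu (n - 1 - b))
      exact ⟨by linarith, by linarith⟩
    have hc : 0 ≤ (n.choose b : ℝ) * (u ^ (n - 1)) ^ b := by positivity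
    have habs : |(-1 : ℝ) ^ b * v ^ b| ≤ 1 := by
      rw [abs_mul, abs_pow, abs_neg, abs_one, one_pow, one_mul, abs_of_nonneg (pow_nonneg hv b)]
      exact pow_le_one₀ hv hv1
    have h1 : 0 ≤ (1 - u ^ (n - b)) ^ b := pow_nonneg (hpow _).1 _
    have h2 : 0 ≤ (1 - v * u ^ (n - 1 - b)) ^ (n - b) := pow_nonneg hvu.1 _
    have h1' : (1 - u ^ (n - b)) ^ b ≤ 1 := pow_le_one₀ (hpow _).1 (hpow _).2
    have h2' : (1 - v * u ^ (n - 1 - b)) ^ (n - b) ≤ 1 := pow_le_one₀ hvu.1 hvu.2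
    rw [abs_mul, abs_of_nonneg (mul_nonneg (mul_nonneg hc h1) h2)]
    calc _ ≤ 1 * ((n.choose b : ℝ) * (u ^ (n - 1)) ^ b * 1 * 1) := by gcongr
      _ = (n.choose b : ℝ) * (u ^ (n - 1)) ^ b := by ring
      _ ≤ (n : ℝ) ^ b / b.factorial * (u ^ (n - 1)) ^ b := by
          gcongr
          exact Nat.choose_le_pow_div b n
      _ = _ := by rw [mul_pow]; ring

/-- A version of `(1 - l / n) ^ n → exp (-l)` for a bounded sequence of parameters. -/
theorem tendsto_one_sub_pow_sub_exp {a l : ℕ → ℝ} {C : ℝ} (ha : ∀ᶠ n in atTop, 0 ≤ a n ∧ a n ≤ 1)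
    (hl : ∀ n, 0 ≤ l n ∧ l n ≤ C) (h : Tendsto (fun n : ℕ => n * a n - l n) atTop (𝓝 0)) :
    Tendsto (fun n => (1 - a n) ^ n - Real.exp (-l n)) atTop (𝓝 0) := by
  have hb : Tendsto (fun n : ℕ => |n * a n - l n| + C ^ 2 / n) atTop (𝓝 0) := by
    simpa using h.abs.add (tendsto_const_div_atTop_nhds_zero_nat (C ^ 2))
  refine squeeze_zero_norm' ?_ hb
  filter_upwards [ha, eventually_gt_atTop 0, eventually_ge_atTop ⌈C⌉₊] with n han hn hnC
  have hn' : (0 : ℝ) < n := by exact_mod_cast hn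
  have hC : C ≤ n := (Nat.le_ceil C).trans (by exact_mod_cast hnC)
  obtain ⟨hl0, hl1⟩ := hl n
  set x := l n / n with hx
  have hx0 : 0 ≤ x := by positivity
  have hx1 : x ≤ 1 := (div_le_one hn').2 (hl1.trans hC)
  have hexp : Real.exp (-l n) = Real.exp (-x) ^ n := by
    rw [← Real.exp_nat_mul, hx]
    congr 1
    field_simp
  have hle : Real.exp (-x) ≤ 1 := Real.exp_le_one_iff.2 (by linarith)
  rw [Real.norm_eq_abs, hexp]
  -- Both bases lie in `[0, 1]`, so `n`-th powers differ by at most `n` times the difference of the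
  -- bases.
  have h1 := abs_pow_sub_pow_le (1 - a n) (Real.exp (-x)) n
  have h2 : max |1 - a n| |Real.exp (-x)| ^ (n - 1) ≤ 1 := by
    apply pow_le_one₀ (by positivity)
    rw [abs_of_nonneg (by linarith), abs_of_pos (Real.exp_pos _)]
    exact max_le (by linarith) hle
  have h3 : |Real.exp (-x) - 1 - -x| ≤ (-x) ^ 2 :=
    Real.abs_exp_sub_one_sub_id_le (by rw [abs_neg, abs_of_nonneg hx0]; exact hx1)
  have h4 : |1 - a n - Real.exp (-x)| ≤ |x - a n| + x ^ 2 := by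
    have : 1 - a n - Real.exp (-x) = (x - a n) - (Real.exp (-x) - 1 - -x) := by ring
    rw [this]
    refine (abs_sub _ _).trans ?_
    rw [neg_sq] at h3
    linarith
  calc |(1 - a n) ^ n - Real.exp (-x) ^ n|
      ≤ |1 - a n - Real.exp (-x)| * n * max |1 - a n| |Real.exp (-x)| ^ (n - 1) := h1
    _ ≤ |1 - a n - Real.exp (-x)| * n * 1 := by gcongr
    _ ≤ (|x - a n| + x ^ 2) * n * 1 := by gcongr
    _ = |x - a n| * |(n : ℝ)| + l n ^ 2 / n := by
        rw [abs_of_pos hn', hx]; field_simp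
    _ = |n * a n - l n| + l n ^ 2 / n := by
        rw [← abs_mul, sub_mul, hx, div_mul_cancel₀ _ hn'.ne', abs_sub_comm, mul_comm]
    _ ≤ |n * a n - l n| + C ^ 2 / n := by gcongr

variable {u v : ℕ → ℝ} {κ : ℝ}

/-- The power over `b!` comes from the `b` chosen zero columns, the exponential from the absence of
zero rows. Since `v` need not converge, it is kept in the comparison term. -/
theorem tendsto_inclExclTerm_sub (hu : ∀ n, 0 ≤ u n ∧ u n ≤ 1) (hv : ∀ n, 0 ≤ v n ∧ v n ≤ 1)
    (hκ : Tendsto (fun n : ℕ => n * u n ^ (n - 1)) atTop (𝓝 κ)) (hu1 : Tendsto u atTop (𝓝 1))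
    (b : ℕ) :
    Tendsto (fun n => inclExclTerm (u n) (v n) n b -
      (-(v n * κ)) ^ b / b.factorial * Real.exp (-(v n * κ))) atTop (𝓝 0) := by
  have hκ0 : 0 ≤ κ := ge_of_tendsto' hκ fun n => mul_nonneg n.cast_nonneg (pow_nonneg (hu n).1 _)
  have hpos : ∀ᶠ n in atTop, 0 < u n := hu1.eventually (lt_mem_nhds one_pos)
  have hinv : ∀ k : ℕ, Tendsto (fun n => (u n ^ k)⁻¹) atTop (𝓝 1) := by
    intro k
    simpa using (hu1.pow k).inv₀ (by simp)
  have hshift : ∀ k : ℕ, ∀ᶠ n : ℕ in atTop, u n ^ (n - 1 - k) = u n ^ (n - 1) * (u n ^ k)⁻¹ := by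
    intro k
    filter_upwards [hpos, eventually_ge_atTop (k + 1)] with n hn hnk
    rw [pow_sub₀ _ hn.ne' (by omega)]
  have hnu : Tendsto (fun n : ℕ => n * u n ^ (n - 1 - b)) atTop (𝓝 κ) := by
    have := hκ.mul (hinv b)
    rw [mul_one] at this
    refine this.congr' ?_
    filter_upwards [hshift b] with n hn
    rw [hn, mul_assoc]
  have hu0 : Tendsto (fun n => u n ^ (n - 1 - b)) atTop (𝓝 0) :=
    tendsto_zero_of_tendsto_mul_atTop hnu
  have hu0' : Tendsto (fun n => u n ^ (n - b)) atTop (𝓝 0) := by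
    have := hu0.mul hu1
    rw [zero_mul] at this
    refine this.congr' ?_
    filter_upwards [eventually_ge_atTop (b + 1)] with n hn
    rw [← pow_succ]
    congr 1
    omega
  set a : ℕ → ℝ := fun n => v n * u n ^ (n - 1 - b) with ha_def
  have ha01 : ∀ n, 0 ≤ a n ∧ a n ≤ 1 := fun n =>
    ⟨mul_nonneg (hv n).1 (pow_nonneg (hu n).1 _),
      mul_le_one₀ (hv n).2 (pow_nonneg (hu n).1 _) (pow_le_one₀ (hu n).1 (hu n).2)⟩
  have hvb : ∀ᶠ n in atTop, |v n| ≤ 1 := Eventually.of_forall fun n => by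
    rw [abs_of_nonneg (hv n).1]; exact (hv n).2
  have ha0 : Tendsto a atTop (𝓝 0) := bdd_le_mul_tendsto_zero' 1 hvb hu0
  have hexp : Tendsto (fun n => (1 - a n) ^ n - Real.exp (-(v n * κ))) atTop (𝓝 0) := by
    refine tendsto_one_sub_pow_sub_exp (C := κ) (Eventually.of_forall ha01)
      (fun n => ⟨mul_nonneg (hv n).1 hκ0, mul_le_of_le_one_left hκ0 (hv n).2⟩) ?_
    have := bdd_le_mul_tendsto_zero' 1 hvb (g := fun n : ℕ => n * u n ^ (n - 1 - b) - κ)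
      (by simpa using hnu.sub_const κ)
    refine this.congr fun n => ?_
    simp only [ha_def]
    ring
  -- `G` collects the factors that converge by themselves, including the correction from exponent `n
  -- - b` to `n`.
  set G : ℕ → ℝ := fun n => (n.choose b * (u n ^ (n - 1)) ^ b) * (1 - u n ^ (n - b)) ^ b *
    ((1 - a n) ^ b)⁻¹ with hG_def
  have hG : Tendsto G atTop (𝓝 (κ ^ b / b.factorial)) := by
    have h1 := tendsto_choose_mul_pow_atTop b hκ
    have h2 := (hu0'.const_sub 1).pow b
    have h3 := ((ha0.const_sub 1).pow b).inv₀ (by simp)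
    simpa using (h1.mul h2).mul h3
  have hdiff : Tendsto (fun n => (1 - a n) ^ n * (G n - κ ^ b / b.factorial) +
      κ ^ b / b.factorial * ((1 - a n) ^ n - Real.exp (-(v n * κ)))) atTop (𝓝 0) := by
    have h1 := bdd_le_mul_tendsto_zero' (f := fun n => (1 - a n) ^ n) 1
      (Eventually.of_forall fun n => by
        obtain ⟨h0, h1⟩ := ha01 n
        rw [abs_of_nonneg (pow_nonneg (by linarith) _)]
        exact pow_le_one₀ (by linarith) (by linarith))
      (g := fun n => G n - κ ^ b / b.factorial) (by simpa using hG.sub_const (κ ^ b / b.factorial))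
    simpa using h1.add (hexp.const_mul (κ ^ b / b.factorial))
  have hfin := bdd_le_mul_tendsto_zero' (f := fun n => (-1 : ℝ) ^ b * v n ^ b) 1
    (Eventually.of_forall fun n => by
      rw [abs_mul, abs_pow, abs_neg, abs_one, one_pow, one_mul, abs_of_nonneg
        (pow_nonneg (hv n).1 b)]
      exact pow_le_one₀ (hv n).1 (hv n).2) hdiff
  refine hfin.congr' ?_
  filter_upwards [eventually_ge_atTop (b + 1), ha0.eventually (gt_mem_nhds one_pos)]
    with n hn han
  rw [inclExclTerm_eq _ _ hn, neg_pow (v n * κ), mul_pow]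
  have h1 : (1 - v n * u n ^ (n - 1 - b)) ^ (n - b) = (1 - a n) ^ n * ((1 - a n) ^ b)⁻¹ :=
    pow_sub₀ _ (by linarith) (by omega)
  rw [h1, hG_def]
  ring

/-- The Poisson approximation for the inclusion-exclusion formula. -/
theorem tendsto_sum_inclExclTerm_sub (hu : ∀ n, 0 ≤ u n ∧ u n ≤ 1)
    (hv : ∀ n, 0 ≤ v n ∧ v n ≤ 1) (hκ : Tendsto (fun n : ℕ => n * u n ^ (n - 1)) atTop (𝓝 κ))
    (hu1 : Tendsto u atTop (𝓝 1)) :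
    Tendsto (fun n => ∑ b ∈ Finset.range (n + 1), inclExclTerm (u n) (v n) n b -
      Real.exp (-2 * v n * κ)) atTop (𝓝 0) := by
  have hκ0 : 0 ≤ κ := ge_of_tendsto' hκ fun n => mul_nonneg n.cast_nonneg (pow_nonneg (hu n).1 _)
  -- Once `n * u ^ (n - 1) ≤ κ + 1`, the term and its limit form are each at most `(κ + 1) ^ b /
  -- b!`; hence the factor 2.
  have hmain := tendsto_tsum_of_dominated_convergence
    ((Real.summable_pow_div_factorial (κ + 1)).mul_left 2)
    (tendsto_inclExclTerm_sub hu hv hκ hu1) (by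
      filter_upwards [eventually_gt_atTop 0, hκ.eventually_le_const (lt_add_one κ)] with n hn hnκ b
      have h1 := abs_inclExclTerm_le (hu n).1 (hu n).2 (hv n).1 (hv n).2 hn b
      have h2 : (n * u n ^ (n - 1)) ^ b / b.factorial ≤ (κ + 1) ^ b / b.factorial := by
        have := (hu n).1
        gcongr
      have h3 : |(-(v n * κ)) ^ b / b.factorial * Real.exp (-(v n * κ))| ≤
          (κ + 1) ^ b / b.factorial := by
        have hvκ : 0 ≤ v n * κ := mul_nonneg (hv n).1 hκ0
        rw [abs_mul, abs_div, abs_pow, abs_neg, abs_of_nonneg hvκ, abs_of_pos (Real.exp_pos _),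
          Nat.abs_cast]
        calc (v n * κ) ^ b / b.factorial * Real.exp (-(v n * κ))
            ≤ (κ + 1) ^ b / b.factorial * 1 := by
              gcongr
              · linarith [mul_le_of_le_one_left hκ0 (hv n).2]
              · exact Real.exp_le_one_iff.2 (by linarith)
          _ = _ := mul_one _
      rw [Real.norm_eq_abs]
      refine (abs_sub _ _).trans ?_
      linarith)
  rw [tsum_zero] at hmain
  refine hmain.congr' ?_
  filter_upwards [eventually_gt_atTop 0] with n hn
  have hs1 : HasSum (inclExclTerm (u n) (v n) n)
      (∑ b ∈ Finset.range (n + 1), inclExclTerm (u n) (v n) n b) :=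
    hasSum_sum_of_ne_finset_zero fun b hb => inclExclTerm_eq_zero _ _ hn (by
      rw [Finset.mem_range] at hb
      omega)
  have hs2 : HasSum (fun b : ℕ => (-(v n * κ)) ^ b / b.factorial * Real.exp (-(v n * κ)))
      (Real.exp (-(v n * κ)) * Real.exp (-(v n * κ))) := by
    have := NormedSpace.expSeries_div_hasSum_exp (-(v n * κ))
    rw [← Real.exp_eq_exp_ℝ] at this
    exact this.mul_right _
  rw [(hs1.sub hs2).tsum_eq, ← Real.exp_add]
  ring_nf

end Poisson

/-! ### The critical window -/

section Constant

variable {p q : ℕ → I} {c ε : ℕ → ℝ}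
  (hp : ∀ᶠ n : ℕ in atTop, (p n : ℝ) = (Real.log n + c n + ε n) / n)
include hp

/-- Here `u = 1 - p`, `v = 1 - q` and `κ = exp (-c₀)`; the limit of `n * u ^ (n - 1)` follows by
squeezing `n * u ^ n` and using `u → 1`. -/
theorem tendsto_hamiltonian_sub_exp (hε : Tendsto ε atTop (𝓝 0)) {c₀ : ℝ}
    (hc : ∀ n, c n = c₀) :
    Tendsto (fun n => (gnpq n (p n) (q n)).real {G | HasHamiltonianDecomposition G} -
      Real.exp (-2 * (1 - (q n : ℝ)) * Real.exp (-c₀))) atTop (𝓝 0) := by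
  have hL := eventually_mul_eq hp
  have hcε : Tendsto (fun n => c n + ε n) atTop (𝓝 c₀) := by
    simpa [hc] using hε.const_add c₀
  obtain ⟨hsq, hp0⟩ := tendsto_mul_sq_zero hp (hcε.eventually_le_const (lt_add_one c₀))
  have hu1 : Tendsto (fun n => 1 - (p n : ℝ)) atTop (𝓝 1) := by simpa using hp0.const_sub 1
  have hexp : Tendsto (fun n => Real.exp (-(c n + ε n))) atTop (𝓝 (Real.exp (-c₀))) :=
    (Real.continuous_exp.tendsto _).comp hcε.neg
  have hexp' : Tendsto (fun n : ℕ => Real.exp (-(c n + ε n) - 2 * (n * (p n : ℝ) ^ 2))) atTop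
      (𝓝 (Real.exp (-c₀))) := by
    refine (Real.continuous_exp.tendsto _).comp ?_
    simpa using hcε.neg.sub (hsq.const_mul 2)
  have hnexp : ∀ᶠ n : ℕ in atTop, ∀ x : ℝ,
      Real.exp (-(c n + ε n) + x) = n * Real.exp (-(n * p n) + x) := by
    filter_upwards [hL, eventually_gt_atTop 0] with n hn hn0 x
    calc Real.exp (-(c n + ε n) + x) = Real.exp (Real.log n + (-(n * p n) + x)) := by
          rw [hn]; ring_nf
      _ = _ := by rw [Real.exp_add, Real.exp_log (by exact_mod_cast hn0)]
  have hun : Tendsto (fun n : ℕ => n * (1 - (p n : ℝ)) ^ n) atTop (𝓝 (Real.exp (-c₀))) := by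
    refine tendsto_of_tendsto_of_tendsto_of_le_of_le' hexp' hexp ?_ ?_
    · filter_upwards [hnexp, hp0.eventually_le_const (by norm_num : (0 : ℝ) < 1 / 2)] with n hn hn2
      rw [sub_eq_add_neg, hn, ← sub_eq_add_neg]
      exact mul_le_mul_of_nonneg_left (exp_le_one_sub_pow (p n).2.1 hn2 n) n.cast_nonneg
    · filter_upwards [hnexp] with n hn
      have h := hn 0
      rw [add_zero, add_zero] at h
      rw [h]
      gcongr
      calc (1 - (p n : ℝ)) ^ n ≤ Real.exp (-(p n : ℝ)) ^ n :=
            pow_le_pow_left₀ (by linarith [(p n).2.2]) (Real.one_sub_le_exp_neg _) _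
        _ = _ := by rw [← Real.exp_nat_mul]; ring_nf
  have hκ : Tendsto (fun n : ℕ => n * (1 - (p n : ℝ)) ^ (n - 1)) atTop (𝓝 (Real.exp (-c₀))) := by
    have := hun.mul (hu1.inv₀ one_ne_zero)
    rw [inv_one, mul_one] at this
    refine this.congr' ?_
    filter_upwards [hu1.eventually (lt_mem_nhds one_pos), eventually_gt_atTop 0] with n hn hn0
    rw [pow_sub₀ _ hn.ne' hn0, pow_one, mul_assoc]
  have h1 := tendsto_sum_inclExclTerm_sub (u := fun n => 1 - (p n : ℝ))
    (v := fun n => 1 - (q n : ℝ))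
    (fun n => ⟨by linarith [(p n).2.2], by linarith [(p n).2.1]⟩)
    (fun n => ⟨by linarith [(q n).2.2], by linarith [(q n).2.1]⟩) hκ hu1
  have h2 := tendsto_noZero_sub p q (-(c₀ - 1)) (by
    filter_upwards [hL, hcε.eventually_const_le (sub_one_lt c₀)] with n hn hn'
    linarith)
  have h3 := h2.add h1
  rw [add_zero] at h3
  refine h3.congr fun n => ?_
  rw [edgeLaw_real_noZero]
  simp only [inclExclTerm]
  ring

end Constant

end RandomDigraph
theorem mainTheorem7 (p q : ℕ → unitInterval) (c ε : ℕ → ℝ)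
    (hε : Tendsto ε atTop (𝓝 0))
    (hp : ∀ᶠ n : ℕ in atTop, (p n : ℝ) = (Real.log n + c n + ε n) / n) :
    (Tendsto c atTop atTop →
      Tendsto (fun n : ℕ => (RandomDigraph.gnpq n (p n) (q n)).real
        {G | RandomDigraph.HasHamiltonianDecomposition G}) atTop (𝓝 1)) ∧
    (∀ c₀ : ℝ, (∀ n, c n = c₀) →
      Tendsto (fun n : ℕ => (RandomDigraph.gnpq n (p n) (q n)).real
          {G | RandomDigraph.HasHamiltonianDecomposition G}
        - Real.exp (-2 * (1 - (q n : ℝ)) * Real.exp (-c₀))) atTop (𝓝 0)) ∧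
    (Tendsto c atTop atBot →
      Tendsto (fun n : ℕ => (1 - (q n : ℝ)) * Real.exp (-c n)) atTop atTop →
      Tendsto (fun n : ℕ => (RandomDigraph.gnpq n (p n) (q n)).real
        {G | RandomDigraph.HasHamiltonianDecomposition G}) atTop (𝓝 0)) :=
  ⟨RandomDigraph.tendsto_hamiltonian_one hp hε,
    fun _ hc => RandomDigraph.tendsto_hamiltonian_sub_exp hp hε hc,
    RandomDigraph.tendsto_hamiltonian_zero hp hε⟩
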